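/- Let $n\ge 1$. Let $W(B_n)=\{\pm1\}^n\rtimes S_n$ be the group of signed permutations acting on $E=\mathbb R^n$, and let $W(D_n)\subset W(B_n)$ be the subgroup of signed permutations with an even number of signs $-1$. For $W=W(B_n)$ or $W(D_n)$, let $R(W)$ be the Grothendieck group of finite-dimensional complex representations of $W$, and let $\overline R(W)$ be the quotient of $R(W)$ by the radical of the elliptic pairing $\langle\sigma,\sigma'\rangle^{\mathrm{ell}}_W=\frac1{|W|}\sum_{w\in W}\sigma(w)\sigma'(w)\det_E(1-w)$. The elliptic fake degree of a class $[\pi]\in\overline R(W)$ is $$F^W_{[\pi]}=\frac{(q-1)^n}{|W|}\sum_{w\in W}\pi(w)\,\frac{\det_E(1-w)}{\det_E(1-qw)},$$ a rational function in $q$ that depends only on the class $[\pi]$; write $F^{B_n}$ and $F^{D_n}$ for the two cases. For a partition $\lambda$ of $n$, let $\sigma_\lambda$ be the irreducible representation of $S_n$ attached to $\lambda$ (so that $\sigma_{(n)}$ is trivial and $\sigma_{(1,\dots,1)}$ is the sign), let $\lambda\times\emptyset$ be the irreducible representation of $W(B_n)$ obtained by inflating $\sigma_\lambda$ along $W(B_n)\to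 S_n$, and denote its restriction to $W(D_n)$ also by $\lambda\times\emptyset$. Let $\lambda^t$ be the transposed partition, $n(\lambda)=\sum_{i\ge1}(i-1)\lambda_i$, $c(i,j)=j-i$ the content of a box $(i,j)$ (row $i$, column $j$) of the Young diagram of $\lambda$, and $h(i,j)$ its hook length in $\lambda$. Then $$F^{D_n}_{[\lambda\times\emptyset]}=F^{B_n}_{[\lambda\times\emptyset]}+(-1)^nF^{B_n}_{[\lambda^t\times\emptyset]}$$ and $$F^{D_n}_{[\lambda\times\emptyset]}=\frac{(q-1)^n}{\prod_{(i,j)\in\lambda}(1-q^{2h(i,j)})}\left(q^{2n(\lambda)}\prod_{(i,j)\in\lambda}(1-q^{2c(i,j)+1})+(-1)^nq^{2n(\lambda^t)}\prod_{(i',j')\in\lambda^t}(1-q^{2c(i',j')+1})\right).$$ -/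

import Mathlib

/-! ### Elliptic theory of a finite group `W` acting on `E = ℝ^l` -/

section Elliptic

/-- The Grothendieck group `R(W)` of finite-dimensional complex representations of `W`, realised as
the group of virtual characters, i.e. the additive group of functions on `W` generated by the
characters of all finite-dimensional complex representations. -/
def VirtualChar (W : Type) [Group W] : AddSubgroup (W → ℂ) :=
  AddSubgroup.closure {χ : W → ℂ |
    ∃ (V : Type) (_ : AddCommGroup V) (_ : Module ℂ V) (_ : FiniteDimensional ℂ V)
      (ρ : Representation ℂ W V), χ = ρ.character}

/-- The element of `R(W)` given by a finite-dimensional representation. -/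
noncomputable def VirtualChar.ofRep {W : Type} [Group W] {V : Type} [AddCommGroup V] [Module ℂ V]
    [FiniteDimensional ℂ V] (ρ : Representation ℂ W V) : VirtualChar W :=
  ⟨ρ.character, AddSubgroup.subset_closure ⟨V, _, _, inferInstance, ρ, rfl⟩⟩

/-- `R(W)` is closed under complex conjugation. -/
theorem VirtualChar.conj_mem {W : Type} [Group W] (σ : W → ℂ) (hσ : σ ∈ VirtualChar W) :
    (fun w => (starRingEnd ℂ) (σ w)) ∈ VirtualChar W := by
  induction hσ using AddSubgroup.closure_induction with
  | mem χ hχ =>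
    obtain ⟨V, _, _, _, ρ, rfl⟩ := hχ
    let b := Module.finBasis ℂ V
    let ρ' : Representation ℂ W (Fin (Module.finrank ℂ V) → ℂ) :=
      { toFun := fun w => Matrix.toLin' ((LinearMap.toMatrix b b (ρ w)).map (starRingEnd ℂ))
        map_one' := by
          rw [map_one, LinearMap.toMatrix_one, Matrix.map_one _ (map_zero _) (map_one _),
            Matrix.toLin'_one]
          rfl
        map_mul' := fun x y => by
          rw [map_mul, LinearMap.toMatrix_mul, Matrix.map_mul, Matrix.toLin'_mul]
          rfl }
    refine AddSubgroup.subset_closure ⟨_, _, _, inferInstance, ρ', ?_⟩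
    funext w
    simp only [Representation.character, ρ', MonoidHom.coe_mk, OneHom.coe_mk,
      Matrix.trace_toLin'_eq]
    rw [LinearMap.trace_eq_matrix_trace ℂ b (ρ w)]
    simp [Matrix.trace]
  | zero =>
    have := (VirtualChar W).zero_mem
    convert this using 1
    funext w; simp
  | add x y _ _ hx hy =>
    have := (VirtualChar W).add_mem hx hy
    convert this using 1
    funext w; simp
  | neg x _ hx =>
    have := (VirtualChar W).neg_mem hx
    convert this using 1
    funext w; simp

variable {W : Type} [Group W] [Fintype W] {l : ℕ}

/-- The elliptic pairing `⟨σ, σ'⟩ = |W|⁻¹ ∑_w σ(w) σ'(w) det_E(1 - w)` on `R(W)`, where `W` acts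
on `E = ℝ^l` through `E : W →* Mat_l(ℝ)`. (No complex conjugation is needed: the characters of the
Weyl groups considered here are real-valued.) -/
noncomputable def ellPairing (E : W →* Matrix (Fin l) (Fin l) ℝ) (σ σ' : VirtualChar W) : ℂ :=
  (Fintype.card W : ℂ)⁻¹ * ∑ w : W, σ.1 w * σ'.1 w * (((1 - E w).det : ℝ) : ℂ)

/-- The radical of the elliptic pairing. -/
def ellRadical (E : W →* Matrix (Fin l) (Fin l) ℝ) : AddSubgroup (VirtualChar W) where
  carrier := {σ | ∀ σ' : VirtualChar W, ellPairing E σ σ' = 0}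
  zero_mem' := fun σ' => by simp [ellPairing]
  add_mem' := fun {a b} ha hb σ' => by
    have h : ellPairing E (a + b) σ' = ellPairing E a σ' + ellPairing E b σ' := by
      simp [ellPairing, add_mul, Finset.sum_add_distrib, mul_add]
    rw [h, ha σ', hb σ', add_zero]
  neg_mem' := fun {a} ha σ' => by
    have h : ellPairing E (-a) σ' = - ellPairing E a σ' := by
      simp [ellPairing]
    rw [h, ha σ', neg_zero]

/-- The space `R̄(W)` of virtual elliptic representations: `R(W)` modulo the radical of the
elliptic pairing. -/
abbrev EllRep (E : W →* Matrix (Fin l) (Fin l) ℝ) : Type :=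
  VirtualChar W ⧸ ellRadical E

/-- The polynomial `det_E(1 - q w)`, as an element of `ℂ(q)`. -/
noncomputable def detOneSubQ (E : W →* Matrix (Fin l) (Fin l) ℝ) (w : W) : RatFunc ℂ :=
  algebraMap (Polynomial ℂ) (RatFunc ℂ) (((E w).map (algebraMap ℝ ℂ)).charpolyRev)

/-- `(q - 1)^l / |W| * ∑_w π(w) det(1 - w) / det(1 - q w)` for a virtual character `π`. -/
noncomputable def ellFakeDegreeAux (E : W →* Matrix (Fin l) (Fin l) ℝ) :
    VirtualChar W →+ RatFunc ℂ where
  toFun π := (RatFunc.X - 1) ^ l / (Fintype.card W : RatFunc ℂ) *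
    ∑ w : W, RatFunc.C (π.1 w) * RatFunc.C (((1 - E w).det : ℝ) : ℂ) / detOneSubQ E w
  map_zero' := by simp
  map_add' π π' := by
    simp [add_mul, add_div, Finset.sum_add_distrib, mul_add]

/-- For an element `w` of finite order, `det_E(1 - w)` is nonnegative. -/
theorem det_one_sub_nonneg (E : W →* Matrix (Fin l) (Fin l) ℝ) (w : W) :
    0 ≤ (1 - E w).det := by
  by_contra! hneg
  set M := E w with hM
  have hpow : M ^ Fintype.card W = 1 := by rw [hM, ← map_pow, pow_card_eq_one, map_one]
  have hcont : ContinuousOn (fun t : ℝ => (1 - t • M).det) (Set.Icc 0 1) := by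
    apply Continuous.continuousOn
    apply Continuous.matrix_det
    fun_prop
  have h0 : (0 : ℝ) ∈ Set.Icc ((1 - (1 : ℝ) • M).det) ((1 - (0 : ℝ) • M).det) := by
    constructor
    · simpa using hneg.le
    · simp
  obtain ⟨t, ht, hdet⟩ := intermediate_value_Icc' zero_le_one hcont h0
  have ht1 : t ≠ 1 := by
    rintro rfl
    simp only [one_smul] at hdet
    exact hneg.ne hdet
  have hlt : t < 1 := lt_of_le_of_ne ht.2 ht1
  have hprod : (1 - t • M) * (∑ i ∈ Finset.range (Fintype.card W), (t • M) ^ i)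
      = (1 - t ^ Fintype.card W) • (1 : Matrix (Fin l) (Fin l) ℝ) := by
    rw [mul_neg_geom_sum, smul_pow, hpow, sub_smul, one_smul]
  have hd := congrArg Matrix.det hprod
  rw [Matrix.det_mul, Matrix.det_smul, Matrix.det_one, mul_one] at hd
  have hdet' : (1 - t • M).det = 0 := hdet
  rw [hdet', zero_mul] at hd
  have hc : t ^ Fintype.card W < 1 := pow_lt_one₀ ht.1 hlt Fintype.card_ne_zero
  have : (1 - t ^ Fintype.card W) ^ Fintype.card (Fin l) ≠ 0 :=
    pow_ne_zero _ (by linarith)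
  exact this hd.symm

/-- The elliptic fake degree only depends on the class in `R̄(W)`. -/
theorem ellRadical_le_ker (E : W →* Matrix (Fin l) (Fin l) ℝ) :
    ellRadical E ≤ (ellFakeDegreeAux E).ker := by
  intro π hπ
  have h := hπ ⟨_, VirtualChar.conj_mem π.1 π.2⟩
  have hW : ((Fintype.card W : ℂ))⁻¹ ≠ 0 := by simp
  have h2 := (mul_eq_zero.mp h).resolve_left hW
  have h3 : ∑ w : W, Complex.normSq (π.1 w) * (1 - E w).det = 0 := by
    simp only [Complex.mul_conj] at h2
    exact_mod_cast h2
  have h4 := (Finset.sum_eq_zero_iff_of_nonneg (fun w _ =>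
    mul_nonneg (Complex.normSq_nonneg _) (det_one_sub_nonneg E w))).mp h3
  rw [AddMonoidHom.mem_ker]
  change (RatFunc.X - 1) ^ l / (Fintype.card W : RatFunc ℂ) *
    ∑ w : W, RatFunc.C (π.1 w) * RatFunc.C (((1 - E w).det : ℝ) : ℂ) / detOneSubQ E w = 0
  rw [Finset.sum_eq_zero, mul_zero]
  intro w hw
  rcases mul_eq_zero.mp (h4 w hw) with h5 | h5
  · rw [Complex.normSq_eq_zero.mp h5]; simp
  · rw [h5]; simp

/-- The elliptic fake degree `F_{[π]} ∈ ℂ(q)` of a class `[π] ∈ R̄(W)`. -/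
noncomputable def ellFakeDegree (E : W →* Matrix (Fin l) (Fin l) ℝ) : EllRep E →+ RatFunc ℂ :=
  QuotientAddGroup.lift (ellRadical E) (ellFakeDegreeAux E) (ellRadical_le_ker E)

/-- The class `[ρ] ∈ R̄(W)` of a finite-dimensional representation. -/
noncomputable def EllRep.ofRep (E : W →* Matrix (Fin l) (Fin l) ℝ) {V : Type} [AddCommGroup V] [Module ℂ V]
    [FiniteDimensional ℂ V] (ρ : Representation ℂ W V) : EllRep E :=
  QuotientAddGroup.mk (VirtualChar.ofRep ρ)

end Elliptic

/-! ### The Weyl groups of types `B_n` and `D_n` -/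

/-- The Weyl group `W(B_n) = {±1}^n ⋊ S_n` of signed permutations. -/
abbrev WeylB (n : ℕ) : Type :=
  (Fin n → ℤˣ) ⋊[(mulAutArrow : Equiv.Perm (Fin n) →* MulAut (Fin n → ℤˣ))] Equiv.Perm (Fin n)

noncomputable instance (n : ℕ) : Fintype (WeylB n) :=
  Fintype.ofEquiv _ SemidirectProduct.equivProd.symm

/-- The reflection representation of `W(B_n)` on `ℝ^n`: the element `(ε, σ)` maps the basis vector
`e_j` to `ε_{σ(j)} e_{σ(j)}`. -/
def reflB (n : ℕ) : WeylB n →* Matrix (Fin n) (Fin n) ℝ where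
  toFun w := Matrix.of fun i j => if i = w.right j then (((w.left i : ℤˣ) : ℤ) : ℝ) else 0
  map_one' := by
    ext i j
    simp [Matrix.one_apply]
  map_mul' x y := by
    ext i j
    rw [Matrix.mul_apply, Finset.sum_eq_single (y.right j)]
    · by_cases h : i = x.right (y.right j)
      · subst h
        have h : (mulAutArrow x.right y.left) (x.right (y.right j)) = y.left (y.right j) := by
          change y.left (x.right⁻¹ • (x.right (y.right j))) = _
          simp
        simp [h, -mulAutArrow_apply_apply]
      · simp [h]
    · intro k _ hk
      simp [hk]
    · simp

/-- The Weyl group `W(D_n)`: the signed permutations with an even number of signs `-1`. -/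
def WeylD (n : ℕ) : Subgroup (WeylB n) where
  carrier := {w | ∏ i, w.left i = 1}
  one_mem' := by simp
  mul_mem' {x y} hx hy := by
    have h : ∏ i, y.left (x.right⁻¹ i) = ∏ i, y.left i := Equiv.prod_comp x.right⁻¹ y.left
    simp only [Set.mem_ofPred_eq] at hx hy ⊢
    simp only [SemidirectProduct.mul_left, Pi.mul_apply, Finset.prod_mul_distrib, hx, one_mul]
    exact h.trans hy
  inv_mem' {x} hx := by
    have h : ∏ i, x.left⁻¹ (x.right i) = ∏ i, x.left⁻¹ i := Equiv.prod_comp x.right x.left⁻¹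
    simp only [Set.mem_ofPred_eq] at hx ⊢
    have h' : ∏ i, x.left⁻¹ i = 1 := by simp [hx]
    rw [← h', ← h]
    refine Finset.prod_congr rfl fun i _ => ?_
    rw [SemidirectProduct.inv_left]
    change x.left⁻¹ (x.right⁻¹⁻¹ • i) = _
    rw [inv_inv]
    rfl

noncomputable instance (n : ℕ) : Fintype (WeylD n) := Fintype.ofFinite _

/-- The reflection representation of `W(D_n)` on `ℝ^n`. -/
def reflD (n : ℕ) : WeylD n →* Matrix (Fin n) (Fin n) ℝ :=
  (reflB n).comp (WeylD n).subtype

/-! ### The irreducible representations `σ_λ` of `S_n` and `λ × ∅` of `W(B_n)`, `W(D_n)` -/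

section Specht

variable {n : ℕ} {lam : YoungDiagram}

/-- For a tableau `T` (a bijection from the boxes of `lam` to `{0, …, n-1}`), the row symmetrizer
`∑ p`, over the permutations `p` that keep every entry in its row. -/
noncomputable def rowSymmetrizer (T : lam.cells ≃ Fin n) : MonoidAlgebra ℂ (Equiv.Perm (Fin n)) :=
  open Classical in
  ∑ p : Equiv.Perm (Fin n) with ∀ x, (T.symm (p x)).1.1 = (T.symm x).1.1,
    MonoidAlgebra.of ℂ _ p

/-- The column antisymmetrizer `∑ sgn(p) p`, over the permutations `p` that keep every entry of `T`
in its column. -/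
noncomputable def colAntisymmetrizer (T : lam.cells ≃ Fin n) :
    MonoidAlgebra ℂ (Equiv.Perm (Fin n)) :=
  open Classical in
  ∑ p : Equiv.Perm (Fin n) with ∀ x, (T.symm (p x)).1.2 = (T.symm x).1.2,
    ((Equiv.Perm.sign p : ℤ) : ℂ) • MonoidAlgebra.of ℂ _ p

/-- The Young symmetrizer of `T`. -/
noncomputable def youngSymmetrizer (T : lam.cells ≃ Fin n) :
    MonoidAlgebra ℂ (Equiv.Perm (Fin n)) :=
  rowSymmetrizer T * colAntisymmetrizer T

/-- The Specht module: the left ideal `ℂ[S_n] c_T` of the group algebra. -/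
noncomputable def spechtModule (T : lam.cells ≃ Fin n) :
    Submodule ℂ (MonoidAlgebra ℂ (Equiv.Perm (Fin n))) :=
  LinearMap.range (LinearMap.mulRight ℂ (youngSymmetrizer T))

/-- `S_n` acting on the Specht module by left multiplication. -/
noncomputable def spechtRep (T : lam.cells ≃ Fin n) :
    Representation ℂ (Equiv.Perm (Fin n)) (spechtModule T) where
  toFun g := (LinearMap.mulLeft ℂ (MonoidAlgebra.of ℂ _ g)).restrict (by
    rintro _ ⟨y, rfl⟩
    exact ⟨MonoidAlgebra.of ℂ _ g * y, by simp [mul_assoc]⟩)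
  map_one' := by
    ext x : 2
    simp only [LinearMap.restrict_apply, LinearMap.mulLeft_apply, map_one, one_mul,
      Module.End.one_apply]
  map_mul' g h := by
    ext x : 2
    simp only [LinearMap.restrict_apply, LinearMap.mulLeft_apply, map_mul, Module.End.mul_apply,
      mul_assoc]

instance (T : lam.cells ≃ Fin n) : FiniteDimensional ℂ (spechtModule T) :=
  FiniteDimensional.finiteDimensional_submodule _

/-- An (arbitrarily chosen) tableau of shape `lam ⊢ n`; the isomorphism class of the Specht module
does not depend on it. -/
noncomputable def someTableau (lam : YoungDiagram) (h : lam.card = n) : lam.cells ≃ Fin n :=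
  lam.cells.equivFinOfCardEq h

/-- The irreducible representation `σ_λ` of `S_n`; `σ_{(n)}` is trivial, `σ_{(1,…,1)}` is `sgn`. -/
noncomputable abbrev sigmaRep (lam : YoungDiagram) (h : lam.card = n) :
    Representation ℂ (Equiv.Perm (Fin n)) (spechtModule (someTableau lam h)) :=
  spechtRep (someTableau lam h)

/-- The irreducible representation `λ × ∅` of `W(B_n)`: the inflation of `σ_λ` along
`W(B_n) → S_n`. -/
noncomputable abbrev repB (lam : YoungDiagram) (h : lam.card = n) :
    Representation ℂ (WeylB n) (spechtModule (someTableau lam h)) :=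
  (sigmaRep lam h).comp SemidirectProduct.rightHom

/-- The representation `λ × ∅` of `W(D_n)`: the restriction of `λ × ∅` from `W(B_n)`. -/
noncomputable abbrev repD (lam : YoungDiagram) (h : lam.card = n) :
    Representation ℂ (WeylD n) (spechtModule (someTableau lam h)) :=
  (repB lam h).comp (WeylD n).subtype

/-- The elliptic fake degree `F^{B_n}_{[λ × ∅]}`. -/
noncomputable def fakeB (lam : YoungDiagram) (h : lam.card = n) : RatFunc ℂ :=
  ellFakeDegree (reflB n) (EllRep.ofRep (reflB n) (repB lam h))

/-- The elliptic fake degree `F^{D_n}_{[λ × ∅]}`. -/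
noncomputable def fakeD (lam : YoungDiagram) (h : lam.card = n) : RatFunc ℂ :=
  ellFakeDegree (reflD n) (EllRep.ofRep (reflD n) (repD lam h))

end Specht

/-! ### Combinatorics of Young diagrams (boxes `(i, j)` are numbered from `0`) -/

namespace YoungDiagram

/-- The transposed diagram has the same number of boxes. -/
theorem card_transpose_eq {n : ℕ} {lam : YoungDiagram} (h : lam.card = n) :
    lam.transpose.card = n := by
  rw [← h]
  simp [YoungDiagram.card, YoungDiagram.transpose]

/-- `n(λ) = ∑ (i - 1) λ_i`, the sum over the rows `i = 1, 2, …`. -/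
def nStat (lam : YoungDiagram) : ℕ := ∑ i ∈ Finset.range (lam.colLen 0), i * lam.rowLen i

/-- The content `c(i, j) = j - i` of a box. -/
def content (x : ℕ × ℕ) : ℤ := (x.2 : ℤ) - (x.1 : ℤ)

/-- The hook length of a box `(i, j)` of `lam`: arm length plus leg length plus one. -/
def hook (lam : YoungDiagram) (x : ℕ × ℕ) : ℕ :=
  (lam.rowLen x.1 - (x.2 + 1)) + (lam.colLen x.2 - (x.1 + 1)) + 1

end YoungDiagram

/-! For w in W(B_n), both determinants factor over the cycles of the underlying permutation. A cycle
of length s and sign e contributes (1 - e)/(1 - e q^s), which vanishes for e = 1 and is 2/(1 + q^s)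
for e = -1. Averaging over the signs (`sum_prod_one_sub_cycleSign`) leaves (q - 1)^n / n! times the
sum over σ in S_n of χ_λ(σ) ∏ 1/(1 + q^s). Since 1/(1 + q^s) = (1 - q^s)/(1 - q^{2s}), this is the
Schur function s_λ at p_s = (1 - u^s)/(1 - t^s) with t = q^2 and u = q. The hook-content formula
`sum_character_mul_prod_cycles` evaluates it, giving the product form `fakeB_eq_prod`.

The hook-content formula needs Frobenius' formula `spechtRep_character_eq_frobFun` for the Specht
character χ, which is compared with the alternating sum ω of permutation characters given by the
Jacobi-Trudi determinant. The norm of χ and its pairing with ω come from the Young symmetrizer, and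
the norm of ω from a coefficient of an alternant; all three are 1. Both functions are real, so they
coincide. At y_k = t^k with k < m the alternants become Vandermonde determinants, which settles u =
t^m; polynomiality in u gives the rest.

For W(D_n), membership is detected by (1 + ∏ ε_i)/2. An orthogonal w with det(1 - w) ≠ 0 has det w =
(-1)^n, so ∏ ε_i = (-1)^n sgn σ there (`prod_left_mul_det_one_sub`). The second half of the sum over
W(B_n) is thus the sign-twisted one, and twisting by the sign transposes λ. -/

/-! ### Fillings of a diagram that are injective on columns. -/

open Finset in
theorem card_filter_lt_and_col_le {n : ℕ} {lam : YoungDiagram} (T : lam.cells ≃ Fin n)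
    (f : Fin n → ℕ)
    (hf : ∀ x y, (T.symm x).1.2 = (T.symm y).1.2 → f x = f y → x = y) (k j : ℕ) :
    #{x : Fin n | f x < k ∧ (T.symm x).1.2 = j} ≤
      #{x : Fin n | (T.symm x).1.1 < k ∧ (T.symm x).1.2 = j} := by
  have h1 : #{x : Fin n | (T.symm x).1.1 < k ∧ (T.symm x).1.2 = j} = min k (lam.colLen j) := by
    rw [← card_range (min k (lam.colLen j))]
    refine card_nbij (fun x => (T.symm x).1.1) ?_ ?_ ?_
    · intro x hx
      simp only [coe_filter, mem_univ, true_and, Set.mem_ofPred_eq] at hx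
      have := (T.symm x).2
      rw [YoungDiagram.mem_cells, YoungDiagram.mem_iff_lt_colLen, hx.2] at this
      simp [hx.1, this]
    · intro x hx y hy hxy
      simp only [coe_filter, mem_univ, true_and, Set.mem_ofPred_eq] at hx hy
      exact T.symm.injective (Subtype.ext (Prod.ext hxy (hx.2.trans hy.2.symm)))
    · intro i hi
      simp only [coe_range, Set.mem_Iio, lt_min_iff] at hi
      have hm : (i, j) ∈ lam.cells := by
        rw [YoungDiagram.mem_cells, YoungDiagram.mem_iff_lt_colLen]; exact hi.2
      exact ⟨T ⟨(i, j), hm⟩, by simp [hi.1], by simp⟩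
  have h2 : #{x : Fin n | f x < k ∧ (T.symm x).1.2 = j} ≤ k := by
    rw [← card_range k]
    refine card_le_card_of_injOn f ?_ ?_
    · intro x hx
      simp only [coe_filter, mem_univ, true_and, Set.mem_ofPred_eq] at hx
      simpa using hx.1
    · intro x hx y hy hxy
      simp only [coe_filter, mem_univ, true_and, Set.mem_ofPred_eq] at hx hy
      exact hf x y (hx.2.trans hy.2.symm) hxy
  have h3 : #{x : Fin n | f x < k ∧ (T.symm x).1.2 = j} ≤ lam.colLen j := by
    rw [← card_range (lam.colLen j)]
    refine card_le_card_of_injOn (fun x => (T.symm x).1.1) ?_ ?_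
    · intro x hx
      simp only [coe_filter, mem_univ, true_and, Set.mem_ofPred_eq] at hx
      have := (T.symm x).2
      rw [YoungDiagram.mem_cells, YoungDiagram.mem_iff_lt_colLen, hx.2] at this
      simpa using this
    · intro x hx y hy hxy
      simp only [coe_filter, mem_univ, true_and, Set.mem_ofPred_eq] at hx hy
      exact T.symm.injective (Subtype.ext (Prod.ext hxy (hx.2.trans hy.2.symm)))
  rw [h1]
  exact le_min h2 h3

open Finset in
theorem card_filter_eq_sum_col {n : ℕ} {lam : YoungDiagram} (T : lam.cells ≃ Fin n)
    (f : Fin n → ℕ) (k : ℕ) :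
    #{x : Fin n | f x < k} =
      ∑ j ∈ univ.image (fun x => (T.symm x).1.2), #{x : Fin n | f x < k ∧ (T.symm x).1.2 = j} := by
  rw [card_eq_sum_card_fiberwise (f := fun x => (T.symm x).1.2)
    (t := univ.image (fun x => (T.symm x).1.2)) (by intro x _; simp)]
  simp only [filter_filter]

-- This is dominance: a column holds at most `min k (colLen j)` entries with values below `k`, and
-- the filling by row numbers attains this bound in every column.
open Finset in
theorem card_filter_lt_le_of_colInjective {n : ℕ} {lam : YoungDiagram} (T : lam.cells ≃ Fin n)
    (f : Fin n → ℕ)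
    (hf : ∀ x y, (T.symm x).1.2 = (T.symm y).1.2 → f x = f y → x = y) (k : ℕ) :
    #{x : Fin n | f x < k} ≤ #{x : Fin n | (T.symm x).1.1 < k} := by
  rw [card_filter_eq_sum_col T, card_filter_eq_sum_col T]
  exact sum_le_sum fun j _ => card_filter_lt_and_col_le T f hf k j

open Finset in
/-- A filling that is injective on columns and has the content of the row filling is obtained from
the row filling by a column permutation. -/
theorem exists_colPerm_of_colInjective {n : ℕ} {lam : YoungDiagram} (T : lam.cells ≃ Fin n)
    (f : Fin n → ℕ)
    (hf : ∀ x y, (T.symm x).1.2 = (T.symm y).1.2 → f x = f y → x = y)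
    (hc : ∀ k, #{x : Fin n | f x < k} = #{x : Fin n | (T.symm x).1.1 < k}) :
    ∃ q : Equiv.Perm (Fin n), (∀ x, (T.symm (q x)).1.2 = (T.symm x).1.2) ∧
      ∀ x, f x = (T.symm (q x)).1.1 := by
  -- Equal totals force equality in each column. Taking `k` to be the length of column `j` shows
  -- that every value of `f` in that column is the row number of a box of it.
  have key : ∀ x, (f x, (T.symm x).1.2) ∈ lam.cells := by
    intro x
    set j := (T.symm x).1.2 with hj
    have h := hc (lam.colLen j)
    rw [card_filter_eq_sum_col T, card_filter_eq_sum_col T,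
      sum_eq_sum_iff_of_le (fun j _ => card_filter_lt_and_col_le T f hf _ j)] at h
    have h := h j (by simp [hj])
    have hall : univ.filter (fun y : Fin n => (T.symm y).1.1 < lam.colLen j ∧ (T.symm y).1.2 = j)
        = univ.filter (fun y => (T.symm y).1.2 = j) := by
      ext y
      simp only [mem_filter, mem_univ, true_and, and_iff_right_iff_imp]
      intro hy
      have := (T.symm y).2
      rwa [YoungDiagram.mem_cells, YoungDiagram.mem_iff_lt_colLen, hy] at this
    rw [hall] at h
    have hs : univ.filter (fun y : Fin n => f y < lam.colLen j ∧ (T.symm y).1.2 = j)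
        = univ.filter (fun y => (T.symm y).1.2 = j) :=
      eq_of_subset_of_card_le (fun y => by simp +contextual) h.ge
    have hx : x ∈ univ.filter (fun y => (T.symm y).1.2 = j) := by simp [hj]
    rw [← hs] at hx
    rw [YoungDiagram.mem_cells, YoungDiagram.mem_iff_lt_colLen]
    simp only [mem_filter, mem_univ, true_and] at hx
    exact hx.1
  let q0 : Fin n → Fin n := fun x => T ⟨(f x, (T.symm x).1.2), key x⟩
  have hq0 : Function.Injective q0 := by
    intro x y hxy
    have := congrArg Subtype.val (T.injective hxy)
    simp only [Prod.mk.injEq] at this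
    exact hf x y this.2 this.1
  refine ⟨Equiv.ofBijective q0 (Finite.injective_iff_bijective.mp hq0), ?_, ?_⟩
  · intro x; simp [q0]
  · intro x; simp [q0]

/-! ### Row lengths, hook lengths and products over boxes. -/

theorem YoungDiagram.rowLen_eq_zero_of_colLen_le (lam : YoungDiagram) {i : ℕ}
    (h : lam.colLen 0 ≤ i) : lam.rowLen i = 0 := by
  by_contra h0
  have : (i, 0) ∈ lam := YoungDiagram.mem_iff_lt_rowLen.mpr (Nat.pos_of_ne_zero h0)
  rw [YoungDiagram.mem_iff_lt_colLen] at this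
  omega

open Finset in
theorem card_filter_row_eq {n : ℕ} {lam : YoungDiagram} (T : lam.cells ≃ Fin n) (i : ℕ) :
    #{x : Fin n | (T.symm x).1.1 = i} = lam.rowLen i := by
  rw [YoungDiagram.rowLen_eq_card]
  refine card_nbij (fun x => (T.symm x).1) ?_ ?_ ?_
  · intro x hx
    simp only [coe_filter, mem_univ, true_and, Set.mem_ofPred_eq] at hx
    simp only [mem_coe, YoungDiagram.mem_row_iff]
    exact ⟨(T.symm x).2, hx⟩
  · intro x hx y hy hxy
    exact T.symm.injective (Subtype.ext hxy)
  · intro c hc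
    simp only [mem_coe, YoungDiagram.mem_row_iff] at hc
    exact ⟨T ⟨c, hc.1⟩, by simp [hc.2], by simp⟩

open Finset in
theorem prod_cells_eq_prod_rows {M : Type*} [CommMonoid M] (lam : YoungDiagram) {m : ℕ}
    (hm : lam.colLen 0 ≤ m) (g : ℕ × ℕ → M) :
    ∏ x ∈ lam.cells, g x = ∏ i ∈ range m, ∏ j ∈ range (lam.rowLen i), g (i, j) := by
  rw [prod_sigma']
  refine prod_nbij' (fun x => ⟨x.1, x.2⟩) (fun x => (x.1, x.2)) ?_ ?_ ?_ ?_ ?_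
  · intro x hx
    have hx' : x.2 < lam.rowLen x.1 := YoungDiagram.mem_iff_lt_rowLen.mp hx
    simp only [mem_sigma, mem_range]
    refine ⟨?_, hx'⟩
    by_contra h
    rw [lam.rowLen_eq_zero_of_colLen_le (by omega)] at hx'
    omega
  · rintro ⟨i, j⟩ hx
    simp only [mem_sigma, mem_range] at hx
    exact YoungDiagram.mem_iff_lt_rowLen.mpr hx.2
  all_goals simp

open Finset in
/-- The hook lengths of a row together with the differences of the shifted parts fill an
interval. -/
theorem prod_hook_row {M : Type*} [CommMonoid M] (lam : YoungDiagram) {m : ℕ}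
    (hm : lam.colLen 0 ≤ m) {i : ℕ} (hi : i < m) (g : ℕ → M) :
    (∏ j ∈ range (lam.rowLen i), g (lam.hook (i, j))) *
      ∏ k ∈ Ioo i m, g (lam.rowLen i - lam.rowLen k + (k - i)) =
    ∏ k ∈ Icc 1 (lam.rowLen i + (m - 1 - i)), g k := by
  have hmem : ∀ j k, j < lam.rowLen k ↔ k < lam.colLen j := fun j k => by
    rw [← YoungDiagram.mem_iff_lt_rowLen, ← YoungDiagram.mem_iff_lt_colLen]
  have hcol : ∀ j, lam.colLen j ≤ m := fun j => (lam.colLen_anti 0 j (Nat.zero_le _)).trans hm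
  have hinj1 : Set.InjOn (fun j => lam.hook (i, j)) (range (lam.rowLen i)) := by
    intro j hj j' hj' h
    simp only [coe_range, Set.mem_Iio] at hj hj'
    have e1 := (hmem _ _).mp hj
    have e2 := (hmem _ _).mp hj'
    simp only [YoungDiagram.hook] at h
    rcases lt_trichotomy j j' with hlt | rfl | hlt
    · have := lam.colLen_anti _ _ hlt.le; omega
    · rfl
    · have := lam.colLen_anti _ _ hlt.le; omega
  have hinj2 : Set.InjOn (fun k => lam.rowLen i - lam.rowLen k + (k - i)) (Ioo i m) := by
    intro k hk k' hk' h
    simp only [coe_Ioo, Set.mem_Ioo] at hk hk'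
    have e1 := lam.rowLen_anti _ _ hk.1.le
    have e2 := lam.rowLen_anti _ _ hk'.1.le
    simp only at h
    rcases lt_trichotomy k k' with hlt | rfl | hlt
    · have := lam.rowLen_anti _ _ hlt.le; omega
    · rfl
    · have := lam.rowLen_anti _ _ hlt.le; omega
  rw [← prod_image (g := fun j => lam.hook (i, j)) (f := g) hinj1,
    ← prod_image (g := fun k => lam.rowLen i - lam.rowLen k + (k - i)) (f := g) hinj2]
  -- The hook length at `(i, j)` exceeds the difference attached to `k` when `(k, j)` is a box, and
  -- is smaller when it is not, so the two are never equal.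
  have hdisj : Disjoint ((range (lam.rowLen i)).image fun j => lam.hook (i, j))
      ((Ioo i m).image fun k => lam.rowLen i - lam.rowLen k + (k - i)) := by
    rw [disjoint_left]
    intro a ha hb
    simp only [mem_image, mem_range, mem_Ioo] at ha hb
    obtain ⟨j, hj, rfl⟩ := ha
    obtain ⟨k, hk, h⟩ := hb
    have e1 := (hmem _ _).mp hj
    have e2 := hmem j k
    have e3 := lam.rowLen_anti _ _ hk.1.le
    simp only [YoungDiagram.hook] at h
    by_cases hjk : j < lam.rowLen k
    · have := e2.mp hjk; omega
    · have : ¬ k < lam.colLen j := fun hh => hjk (e2.mpr hh)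
      omega
  rw [← prod_union hdisj]
  congr 1
  refine eq_of_subset_of_card_le ?_ ?_
  · intro a ha
    simp only [mem_union, mem_image, mem_range, mem_Ioo] at ha
    rw [mem_Icc]
    rcases ha with ⟨j, hj, rfl⟩ | ⟨k, hk, rfl⟩
    · have e1 := (hmem _ _).mp hj
      have := hcol j
      simp only [YoungDiagram.hook]; omega
    · have := lam.rowLen_anti _ _ hk.1.le
      omega
  · rw [card_union_of_disjoint hdisj, card_image_of_injOn hinj1, card_image_of_injOn hinj2]
    simp only [card_range, Nat.card_Icc, Nat.card_Ioo]
    omega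

theorem YoungDiagram.hook_transpose (lam : YoungDiagram) (x : ℕ × ℕ) :
    lam.transpose.hook x = lam.hook x.swap := by
  simp [YoungDiagram.hook, add_comm]

open Finset in
theorem prod_cells_transpose {M : Type*} [CommMonoid M] (lam : YoungDiagram) (g : ℕ × ℕ → M) :
    ∏ x ∈ lam.transpose.cells, g x = ∏ x ∈ lam.cells, g x.swap := by
  refine prod_nbij' Prod.swap Prod.swap ?_ ?_ ?_ ?_ ?_
  · intro x hx; exact YoungDiagram.mem_transpose.mp hx
  · intro x hx
    simp only [YoungDiagram.mem_cells, YoungDiagram.mem_transpose, Prod.swap_swap]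
    exact hx
  all_goals simp

/-! ### Coefficients and traces in a group algebra. -/

namespace MonoidAlgebra

variable {k G : Type*} [Field k] [Group G] [Fintype G]

theorem coeff_mul_eq_sum (x y : MonoidAlgebra k G) (g : G) :
    (x * y).coeff g = ∑ h, x.coeff h * y.coeff (h⁻¹ * g) := by
  rw [coeff_mul_apply_left, Finsupp.sum_fintype]
  simp

theorem eq_sum_of (x : MonoidAlgebra k G) : x = ∑ g, x.coeff g • of k G g := by
  conv_lhs => rw [← sum_coeff_single x]
  rw [Finsupp.sum_fintype]
  · simp
  · simp

theorem trace_eq_sum_coeff (f : MonoidAlgebra k G →ₗ[k] MonoidAlgebra k G) :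
    LinearMap.trace k _ f = ∑ g, (f (of k G g)).coeff g := by
  classical
  rw [LinearMap.trace_eq_matrix_trace k (MonoidAlgebra.basis G k), Matrix.trace]
  refine Finset.sum_congr rfl fun g _ => ?_
  rw [Matrix.diag_apply, LinearMap.toMatrix_apply]
  simp [MonoidAlgebra.basis]

/-- The diagonal entry at the basis element `g` is the coefficient of `g` in `σ g c`. -/
theorem trace_mulLeft_mulRight (c : MonoidAlgebra k G) (σ : G) :
    LinearMap.trace k _ (LinearMap.mulLeft k (of k G σ) ∘ₗ LinearMap.mulRight k c) =
      ∑ g, c.coeff (g⁻¹ * σ⁻¹ * g) := by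
  rw [trace_eq_sum_coeff]
  refine Finset.sum_congr rfl fun g _ => ?_
  simp [coeff_single_mul_apply, mul_assoc]

end MonoidAlgebra

/-! ### Young symmetrizers and characters of Specht modules. -/

section Symmetrizer

open MonoidAlgebra

variable {n : ℕ} {lam : YoungDiagram}

/-- The group of permutations that keep every entry of `T` in its row. -/
def rowGroup (T : lam.cells ≃ Fin n) : Subgroup (Equiv.Perm (Fin n)) where
  carrier := {p | ∀ x, (T.symm (p x)).1.1 = (T.symm x).1.1}
  one_mem' := fun x => rfl
  mul_mem' {p q} hp hq := fun x => (hp (q x)).trans (hq x)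
  inv_mem' {p} hp := fun x => by simpa using (hp (p⁻¹ x)).symm

/-- The group of permutations that keep every entry of `T` in its column. -/
def colGroup (T : lam.cells ≃ Fin n) : Subgroup (Equiv.Perm (Fin n)) where
  carrier := {p | ∀ x, (T.symm (p x)).1.2 = (T.symm x).1.2}
  one_mem' := fun x => rfl
  mul_mem' {p q} hp hq := fun x => (hp (q x)).trans (hq x)
  inv_mem' {p} hp := fun x => by simpa using (hp (p⁻¹ x)).symm

noncomputable instance (T : lam.cells ≃ Fin n) : Fintype (rowGroup T) := Fintype.ofFinite _

noncomputable instance (T : lam.cells ≃ Fin n) : Fintype (colGroup T) := Fintype.ofFinite _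

theorem mem_rowGroup {T : lam.cells ≃ Fin n} {p : Equiv.Perm (Fin n)} :
    p ∈ rowGroup T ↔ ∀ x, (T.symm (p x)).1.1 = (T.symm x).1.1 := Iff.rfl

theorem mem_colGroup {T : lam.cells ≃ Fin n} {p : Equiv.Perm (Fin n)} :
    p ∈ colGroup T ↔ ∀ x, (T.symm (p x)).1.2 = (T.symm x).1.2 := Iff.rfl

theorem eq_one_of_mem_rowGroup_colGroup {T : lam.cells ≃ Fin n} {p : Equiv.Perm (Fin n)}
    (h1 : p ∈ rowGroup T) (h2 : p ∈ colGroup T) : p = 1 :=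
  Equiv.ext fun x => T.symm.injective (Subtype.ext (Prod.ext (h1 x) (h2 x)))

/-- The sign of a permutation, as an element of a ring. -/
def sgn (R : Type*) [Ring R] (p : Equiv.Perm (Fin n)) : R := ((Equiv.Perm.sign p : ℤ) : R)

theorem sgn_mul (R : Type*) [Ring R] (p q : Equiv.Perm (Fin n)) :
    sgn R (p * q) = sgn R p * sgn R q := by simp [sgn]

theorem sgn_inv (R : Type*) [Ring R] (p : Equiv.Perm (Fin n)) : sgn R p⁻¹ = sgn R p := by
  simp [sgn]

theorem sgn_mul_self (R : Type*) [Ring R] (p : Equiv.Perm (Fin n)) : sgn R p * sgn R p = 1 := by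
  rcases Int.units_eq_one_or (Equiv.Perm.sign p) with h | h <;> simp [sgn, h]

theorem sgn_one (R : Type*) [Ring R] : sgn R (1 : Equiv.Perm (Fin n)) = 1 := by simp [sgn]

theorem sgn_swap (R : Type*) [Ring R] {x y : Fin n} (h : x ≠ y) :
    sgn R (Equiv.swap x y) = -1 := by
  simp [sgn, Equiv.Perm.sign_swap h]

theorem rowSymmetrizer_eq (T : lam.cells ≃ Fin n) :
    rowSymmetrizer T = ∑ p : rowGroup T, of ℂ _ (p : Equiv.Perm (Fin n)) := by
  rw [rowSymmetrizer]
  exact Finset.sum_subtype _ (by simp [mem_rowGroup]) _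

theorem colAntisymmetrizer_eq (T : lam.cells ≃ Fin n) :
    colAntisymmetrizer T =
      ∑ q : colGroup T, sgn ℂ (q : Equiv.Perm (Fin n)) • of ℂ _ (q : Equiv.Perm (Fin n)) := by
  rw [colAntisymmetrizer]
  exact Finset.sum_subtype _ (by simp [mem_colGroup]) _

theorem rowSymmetrizer_mul_of {T : lam.cells ≃ Fin n} {p : Equiv.Perm (Fin n)}
    (hp : p ∈ rowGroup T) : rowSymmetrizer T * of ℂ _ p = rowSymmetrizer T := by
  simp only [rowSymmetrizer_eq, Finset.sum_mul, ← map_mul]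
  exact Fintype.sum_equiv (Equiv.mulRight ⟨p, hp⟩) _ _ fun _ => rfl

theorem of_mul_colAntisymmetrizer {T : lam.cells ≃ Fin n} {q : Equiv.Perm (Fin n)}
    (hq : q ∈ colGroup T) :
    of ℂ _ q * colAntisymmetrizer T = sgn ℂ q • colAntisymmetrizer T := by
  simp only [colAntisymmetrizer_eq, Finset.mul_sum, Finset.smul_sum, mul_smul_comm, ← map_mul]
  refine Fintype.sum_equiv (Equiv.mulLeft ⟨q, hq⟩) _ _ fun r => ?_
  simp only [Equiv.coe_mulLeft, Subgroup.coe_mul, sgn_mul, smul_smul, ← mul_assoc, sgn_mul_self,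
    one_mul]

theorem swap_mem_rowGroup {T : lam.cells ≃ Fin n} {x y : Fin n}
    (h : (T.symm x).1.1 = (T.symm y).1.1) : Equiv.swap x y ∈ rowGroup T := by
  intro z
  by_cases hx : z = x
  · subst hx; simp [h]
  · by_cases hy : z = y
    · subst hy; simp [h]
    · rw [Equiv.swap_apply_of_ne_of_ne hx hy]

theorem swap_mem_colGroup {T : lam.cells ≃ Fin n} {x y : Fin n}
    (h : (T.symm x).1.2 = (T.symm y).1.2) : Equiv.swap x y ∈ colGroup T := by
  intro z
  by_cases hx : z = x
  · subst hx; simp [h]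
  · by_cases hy : z = y
    · subst hy; simp [h]
    · rw [Equiv.swap_apply_of_ne_of_ne hx hy]

/-- Von Neumann's dichotomy. Either `g` is a row permutation times a column permutation, and both
factors are absorbed, or `g` sends two entries of one column into one row. In the second case a
transposition is absorbed with sign +1 by the row symmetrizer and -1 by the column antisymmetrizer,
so the product equals its own negative. -/
theorem exists_rowSymmetrizer_mul_of_mul (T : lam.cells ≃ Fin n) (g : Equiv.Perm (Fin n)) :
    ∃ z : ℂ, rowSymmetrizer T * of ℂ _ g * colAntisymmetrizer T = z • youngSymmetrizer T := by
  by_cases hinj : ∀ x y, (T.symm x).1.2 = (T.symm y).1.2 →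
      (T.symm (g x)).1.1 = (T.symm (g y)).1.1 → x = y
  · obtain ⟨q, hq, hgq⟩ := exists_colPerm_of_colInjective T (fun x => (T.symm (g x)).1.1) hinj
      (fun k => Finset.card_equiv g (by simp))
    have hp : g * q⁻¹ ∈ rowGroup T := fun x => by simpa using hgq (q⁻¹ x)
    refine ⟨sgn ℂ q, ?_⟩
    have hg : g = (g * q⁻¹) * q := by simp
    rw [hg, map_mul, ← mul_assoc, rowSymmetrizer_mul_of hp, mul_assoc,
      of_mul_colAntisymmetrizer hq, youngSymmetrizer, mul_smul_comm]
  · push Not at hinj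
    obtain ⟨x, y, hc, hr, hxy⟩ := hinj
    refine ⟨0, ?_⟩
    have h1 := rowSymmetrizer_mul_of (swap_mem_rowGroup hr)
    have h2 := of_mul_colAntisymmetrizer (swap_mem_colGroup hc)
    have h3 : Equiv.swap (g x) (g y) * g = g * Equiv.swap x y := by
      rw [← Equiv.mul_swap_eq_swap_mul]
    have h4 : rowSymmetrizer T * of ℂ _ g * colAntisymmetrizer T =
        -(rowSymmetrizer T * of ℂ _ g * colAntisymmetrizer T) := by
      conv_lhs => rw [← h1, mul_assoc (rowSymmetrizer T), ← map_mul, h3, map_mul, ← mul_assoc,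
        mul_assoc _ _ (colAntisymmetrizer T), h2, sgn_swap ℂ hxy]
      simp
    have h5 : (2 : ℂ) • (rowSymmetrizer T * of ℂ _ g * colAntisymmetrizer T) = 0 := by
      rw [two_smul]
      nth_rewrite 1 [h4]
      exact neg_add_cancel _
    rw [zero_smul]
    exact (smul_eq_zero.mp h5).resolve_left two_ne_zero

theorem exists_rowSymmetrizer_mul_mul (T : lam.cells ≃ Fin n)
    (x : MonoidAlgebra ℂ (Equiv.Perm (Fin n))) :
    ∃ z : ℂ, rowSymmetrizer T * x * colAntisymmetrizer T = z • youngSymmetrizer T := by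
  choose z hz using exists_rowSymmetrizer_mul_of_mul T
  refine ⟨∑ g, x.coeff g * z g, ?_⟩
  conv_lhs => rw [eq_sum_of x]
  simp only [Finset.mul_sum, Finset.sum_mul, mul_smul_comm, smul_mul_assoc, hz, smul_smul,
    Finset.sum_smul]

theorem sum_youngSymmetrizer_coeff_mul (T : lam.cells ≃ Fin n) (φ : Equiv.Perm (Fin n) → ℂ) :
    ∑ τ, (youngSymmetrizer T).coeff τ * φ τ =
      ∑ p : rowGroup T, ∑ q : colGroup T, sgn ℂ (q : Equiv.Perm (Fin n)) * φ (p * q) := by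
  classical
  have h : youngSymmetrizer T = ∑ p : rowGroup T, ∑ q : colGroup T,
      single (p * q : Equiv.Perm (Fin n)) (sgn ℂ (q : Equiv.Perm (Fin n))) := by
    simp [youngSymmetrizer, rowSymmetrizer_eq, colAntisymmetrizer_eq, Finset.sum_mul,
      Finset.mul_sum, single_mul_single]
    rw [Finset.sum_comm]
  simp only [h, coeff_sum, Finsupp.coe_finsetSum, Finset.sum_apply, Finset.sum_mul, coeff_single,
    Finsupp.single_apply, ite_mul, zero_mul]
  rw [Finset.sum_comm]
  refine Finset.sum_congr rfl fun p _ => ?_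
  rw [Finset.sum_comm]
  simp

open Classical in
theorem youngSymmetrizer_coeff (T : lam.cells ≃ Fin n) (τ : Equiv.Perm (Fin n)) :
    (youngSymmetrizer T).coeff τ =
      ∑ p : rowGroup T, ∑ q : colGroup T,
        if (p * q : Equiv.Perm (Fin n)) = τ then sgn ℂ (q : Equiv.Perm (Fin n)) else 0 := by
  have := sum_youngSymmetrizer_coeff_mul T (fun x => if x = τ then 1 else 0)
  simpa using this

theorem youngSymmetrizer_coeff_one (T : lam.cells ≃ Fin n) :
    (youngSymmetrizer T).coeff 1 = 1 := by
  classical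
  rw [youngSymmetrizer_coeff, Fintype.sum_eq_single 1, Fintype.sum_eq_single 1]
  · simp [sgn_one]
  · intro q hq
    rw [if_neg]
    intro h
    exact hq (Subtype.ext (by simpa using h))
  · intro p hp
    refine Finset.sum_eq_zero fun q _ => if_neg fun h => hp (Subtype.ext ?_)
    have hpq : (p : Equiv.Perm (Fin n)) = (q : Equiv.Perm (Fin n))⁻¹ := eq_inv_of_mul_eq_one_left h
    exact eq_one_of_mem_rowGroup_colGroup p.2 (hpq ▸ (colGroup T).inv_mem q.2)

/-- Integrality serves to show that Specht characters are real-valued. -/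
theorem exists_intCast_eq_youngSymmetrizer_coeff (T : lam.cells ≃ Fin n)
    (τ : Equiv.Perm (Fin n)) : ∃ z : ℤ, (youngSymmetrizer T).coeff τ = z := by
  classical
  refine ⟨∑ p : rowGroup T, ∑ q : colGroup T,
    if (p * q : Equiv.Perm (Fin n)) = τ then sgn ℤ (q : Equiv.Perm (Fin n)) else 0, ?_⟩
  rw [youngSymmetrizer_coeff]
  push_cast [sgn]
  rfl

/-- The scalar `κ` with `c_T ^ 2 = κ c_T`. -/
noncomputable def youngScalar (T : lam.cells ≃ Fin n) : ℂ :=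
  (youngSymmetrizer T * youngSymmetrizer T).coeff 1

theorem youngSymmetrizer_mul_mul (T : lam.cells ≃ Fin n)
    (x : MonoidAlgebra ℂ (Equiv.Perm (Fin n))) :
    youngSymmetrizer T * x * youngSymmetrizer T =
      (youngSymmetrizer T * x * youngSymmetrizer T).coeff 1 • youngSymmetrizer T := by
  obtain ⟨z, hz⟩ := exists_rowSymmetrizer_mul_mul T (colAntisymmetrizer T * x * rowSymmetrizer T)
  have h : youngSymmetrizer T * x * youngSymmetrizer T = z • youngSymmetrizer T := by
    rw [← hz]; simp only [youngSymmetrizer, mul_assoc]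
  rw [h, coeff_smul, Finsupp.smul_apply, youngSymmetrizer_coeff_one, smul_eq_mul, mul_one]

theorem youngSymmetrizer_mul_self (T : lam.cells ≃ Fin n) :
    youngSymmetrizer T * youngSymmetrizer T = youngScalar T • youngSymmetrizer T := by
  rw [youngScalar]
  simpa using youngSymmetrizer_mul_mul T 1

/-- If the scalar were 0, right multiplication by the symmetrizer would be nilpotent; but its trace
on the group algebra is `n!` times the coefficient at 1, that is `n!`. -/
theorem youngScalar_ne_zero (T : lam.cells ≃ Fin n) : youngScalar T ≠ 0 := by
  intro h
  have hnil : IsNilpotent (LinearMap.mulLeft ℂ (of ℂ _ (1 : Equiv.Perm (Fin n))) ∘ₗ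
      LinearMap.mulRight ℂ (youngSymmetrizer T)) := by
    refine ⟨2, LinearMap.ext fun x => ?_⟩
    simp [pow_two, mul_assoc, youngSymmetrizer_mul_self, h, -of_apply, map_one]
  have htr := LinearMap.isNilpotent_trace_of_isNilpotent hnil
  rw [trace_mulLeft_mulRight] at htr
  simp [youngSymmetrizer_coeff_one, isNilpotent_iff_eq_zero, Fintype.card_perm,
    Nat.factorial_ne_zero] at htr

theorem youngScalar_eq_sum (T : lam.cells ≃ Fin n) :
    youngScalar T = ∑ τ, (youngSymmetrizer T).coeff τ * (youngSymmetrizer T).coeff τ⁻¹ := by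
  simp [youngScalar, coeff_mul_eq_sum]

/-- Right multiplication by the symmetrizer maps the group algebra onto the Specht module and acts
on it as the scalar κ. Cyclicity of the trace therefore turns κ χ(σ) into the trace of `x ↦ σ x c`
on the whole algebra. -/
theorem youngScalar_mul_character (T : lam.cells ≃ Fin n) (σ : Equiv.Perm (Fin n)) :
    youngScalar T * (spechtRep T).character σ =
      ∑ g, (youngSymmetrizer T).coeff (g⁻¹ * σ⁻¹ * g) := by
  let f : MonoidAlgebra ℂ (Equiv.Perm (Fin n)) →ₗ[ℂ] spechtModule T :=
    (LinearMap.mulRight ℂ (youngSymmetrizer T)).rangeRestrict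
  let i := (spechtModule T).subtype
  have h1 : f ∘ₗ i = youngScalar T • LinearMap.id := by
    refine LinearMap.ext fun y => Subtype.ext ?_
    obtain ⟨_, x, rfl⟩ := y
    change (x * youngSymmetrizer T) * youngSymmetrizer T =
      youngScalar T • (x * youngSymmetrizer T)
    rw [mul_assoc, youngSymmetrizer_mul_self, mul_smul_comm]
  have h2 : i ∘ₗ (spechtRep T σ ∘ₗ f) =
      LinearMap.mulLeft ℂ (of ℂ _ σ) ∘ₗ LinearMap.mulRight ℂ (youngSymmetrizer T) := by
    refine LinearMap.ext fun x => ?_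
    rfl
  rw [← trace_mulLeft_mulRight, ← h2, LinearMap.trace_comp_comm', LinearMap.comp_assoc, h1,
    LinearMap.comp_smul, LinearMap.comp_id, map_smul, smul_eq_mul]
  rfl

theorem spechtRep_character_conj (T : lam.cells ≃ Fin n) (g σ : Equiv.Perm (Fin n)) :
    (spechtRep T).character (g * σ * g⁻¹) = (spechtRep T).character σ :=
  Representation.char_conj _ _ _

/-- Pairing the Specht character with a class function. -/
theorem youngScalar_mul_sum_character_mul (T : lam.cells ≃ Fin n) (φ : Equiv.Perm (Fin n) → ℂ)
    (hφ : ∀ g σ, φ (g * σ * g⁻¹) = φ σ) :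
    youngScalar T * ∑ σ, (spechtRep T).character σ * φ σ⁻¹ =
      n.factorial * ∑ τ, (youngSymmetrizer T).coeff τ * φ τ := by
  simp_rw [Finset.mul_sum, ← mul_assoc, youngScalar_mul_character, Finset.sum_mul]
  rw [Finset.sum_comm]
  have : ∀ g : Equiv.Perm (Fin n),
      ∑ σ, (youngSymmetrizer T).coeff (g⁻¹ * σ⁻¹ * g) * φ σ⁻¹ =
        ∑ τ, (youngSymmetrizer T).coeff τ * φ τ := fun g => by
    refine Fintype.sum_equiv ((Equiv.inv _).trans (MulAut.conj g⁻¹).toEquiv) _ _ fun σ => ?_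
    have := hφ g⁻¹ σ⁻¹
    simp only [inv_inv] at this
    simp [this]
  rw [Finset.sum_congr rfl fun g _ => this g]
  simp [Fintype.card_perm, Finset.mul_sum, mul_assoc]

/-- Multiplied by κ, the left side is the sum over `g` of the coefficient of `g` in `c g c`. As `c g
c` is a multiple of `c`, that sum is the coefficient of 1 in `c ^ 3 = κ ^ 2 c`. -/
theorem sum_youngSymmetrizer_coeff_mul_character (T : lam.cells ≃ Fin n) :
    ∑ τ, (youngSymmetrizer T).coeff τ * (spechtRep T).character τ = youngScalar T := by
  set c := youngSymmetrizer T with hc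
  have h : youngScalar T * ∑ τ, c.coeff τ * (spechtRep T).character τ =
      ∑ g, (c * of ℂ _ g * c).coeff g := by
    simp_rw [Finset.mul_sum, mul_left_comm (youngScalar T), youngScalar_mul_character,
      Finset.mul_sum]
    rw [Finset.sum_comm]
    refine Finset.sum_congr rfl fun g _ => ?_
    rw [mul_assoc, coeff_mul_eq_sum]
    refine Finset.sum_congr rfl fun τ _ => ?_
    simp [coeff_single_mul_apply, mul_assoc, hc]
  have h' : ∑ g, (c * of ℂ _ g * c).coeff g = (c * c * c).coeff 1 := by
    have h3 : c * c * c = ∑ g, c.coeff g • (c * of ℂ _ g * c) := by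
      -- All three factors are expanded and collapsed again, so that only the middle one ends up
      -- expanded.
      conv_lhs => rw [eq_sum_of c]
      conv_lhs => enter [1, 2]; rw [← eq_sum_of c]
      conv_lhs => enter [2]; rw [← eq_sum_of c]
      conv_lhs => enter [1, 1]; rw [← eq_sum_of c]
      conv_lhs => enter [1, 2]; rw [eq_sum_of c]
      simp only [Finset.mul_sum, Finset.sum_mul, mul_smul_comm, smul_mul_assoc]
    rw [h3, coeff_sum, Finsupp.coe_finsetSum, Finset.sum_apply]
    refine Finset.sum_congr rfl fun g _ => ?_
    rw [hc, youngSymmetrizer_mul_mul T]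
    simp [youngSymmetrizer_coeff_one, mul_comm]
  rw [h', youngSymmetrizer_mul_self, smul_mul_assoc, youngSymmetrizer_mul_self] at h
  simp only [coeff_smul, Finsupp.smul_apply, hc, youngSymmetrizer_coeff_one, smul_eq_mul,
    mul_one] at h
  exact mul_left_cancel₀ (youngScalar_ne_zero T) h

theorem sum_spechtRep_character_mul_inv (T : lam.cells ≃ Fin n) :
    ∑ σ, (spechtRep T).character σ * (spechtRep T).character σ⁻¹ = n.factorial := by
  have h := youngScalar_mul_sum_character_mul T _ (spechtRep_character_conj T)
  rw [sum_youngSymmetrizer_coeff_mul_character, mul_comm (n.factorial : ℂ)] at h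
  exact mul_left_cancel₀ (youngScalar_ne_zero T) h

theorem class_fun_inv {α : Type*} (φ : Equiv.Perm (Fin n) → α)
    (hφ : ∀ g σ, φ (g * σ * g⁻¹) = φ σ) (σ : Equiv.Perm (Fin n)) : φ σ⁻¹ = φ σ := by
  obtain ⟨g, hg⟩ := isConj_iff.mp
    (Equiv.Perm.isConj_iff_cycleType_eq.mpr (Equiv.Perm.cycleType_inv σ).symm)
  rw [← hg, hφ]

theorem exists_ofReal_eq_spechtRep_character (T : lam.cells ≃ Fin n) (σ : Equiv.Perm (Fin n)) :
    ∃ r : ℝ, (spechtRep T).character σ = r := by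
  choose z hz using exists_intCast_eq_youngSymmetrizer_coeff T
  have h1 : youngScalar T = ((∑ τ, z τ * z τ⁻¹ : ℤ) : ℂ) := by
    rw [youngScalar_eq_sum]; simp [hz]
  have h2 := youngScalar_mul_character T σ
  simp only [hz] at h2
  refine ⟨(∑ g, z (g⁻¹ * σ⁻¹ * g) : ℤ) / (∑ τ, z τ * z τ⁻¹ : ℤ), ?_⟩
  have h0 := youngScalar_ne_zero T
  rw [eq_div_of_mul_eq h0 ((mul_comm _ _).trans h2), h1]
  push_cast
  rfl

/-- The tableau of transposed shape. -/
def transposeTableau (T : lam.cells ≃ Fin n) : lam.transpose.cells ≃ Fin n where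
  toFun x := T ⟨x.1.swap, YoungDiagram.mem_transpose.mp x.2⟩
  invFun k := ⟨(T.symm k).1.swap, YoungDiagram.mem_transpose.mpr (by simp)⟩
  left_inv x := by simp
  right_inv k := by simp

/-- Transposing exchanges the row and column groups, so the product `p q` is reversed, which
inversion undoes; the factor `sgn τ` moves the sign from one factor to the other. -/
theorem youngSymmetrizer_transposeTableau_coeff (T : lam.cells ≃ Fin n)
    (τ : Equiv.Perm (Fin n)) :
    (youngSymmetrizer (transposeTableau T)).coeff τ =
      sgn ℂ τ * (youngSymmetrizer T).coeff τ⁻¹ := by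
  classical
  rw [youngSymmetrizer_coeff, youngSymmetrizer_coeff, Finset.sum_comm, Finset.mul_sum]
  refine Fintype.sum_equiv (Equiv.inv (rowGroup T)) _ _ fun p => ?_
  rw [Finset.mul_sum]
  refine Fintype.sum_equiv (Equiv.inv (colGroup T)) _ _ fun q => ?_
  change (if (q * p : Equiv.Perm (Fin n)) = τ then sgn ℂ (p : Equiv.Perm (Fin n)) else 0) =
    sgn ℂ τ * if ((p : Equiv.Perm (Fin n))⁻¹ * (q : Equiv.Perm (Fin n))⁻¹) = τ⁻¹ then
      sgn ℂ (q : Equiv.Perm (Fin n))⁻¹ else 0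
  by_cases h : (q * p : Equiv.Perm (Fin n)) = τ
  · rw [if_pos h, if_pos (by rw [← mul_inv_rev, h]), ← h, sgn_mul, sgn_inv, mul_right_comm,
      sgn_mul_self, one_mul]
  · rw [if_neg h, if_neg (by rwa [← mul_inv_rev, inv_inj]), mul_zero]

theorem spechtRep_transposeTableau_character (T : lam.cells ≃ Fin n)
    (σ : Equiv.Perm (Fin n)) :
    (spechtRep (transposeTableau T)).character σ = sgn ℂ σ * (spechtRep T).character σ := by
  have hk : youngScalar (transposeTableau T) = youngScalar T := by
    rw [youngScalar_eq_sum, youngScalar_eq_sum]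
    refine Finset.sum_congr rfl fun τ _ => ?_
    rw [youngSymmetrizer_transposeTableau_coeff, youngSymmetrizer_transposeTableau_coeff,
      sgn_inv, mul_mul_mul_comm, sgn_mul_self, one_mul, inv_inv, mul_comm]
  refine mul_left_cancel₀ (youngScalar_ne_zero T) ?_
  rw [mul_left_comm, ← class_fun_inv _ (spechtRep_character_conj T), youngScalar_mul_character,
    ← hk, youngScalar_mul_character, Finset.mul_sum]
  refine Finset.sum_congr rfl fun g _ => ?_
  rw [youngSymmetrizer_transposeTableau_coeff]
  have hs : sgn ℂ (g⁻¹ * σ⁻¹ * g) = sgn ℂ σ := by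
    rw [sgn_mul, sgn_mul, sgn_inv, sgn_inv, mul_right_comm, sgn_mul_self, one_mul]
  rw [hs]
  simp [mul_assoc]

end Symmetrizer

/-! ### Colorings fixed by permutations, and symmetric functions. -/

section ColorSum

open Finset

variable {n : ℕ}

/-- The number of times that `f` takes each of its values. -/
def contentOf {I : Type*} [DecidableEq I] (f : Fin n → I) (i : I) : ℕ := #{k | f k = i}

theorem prod_comp_eq_prod_pow_contentOf {I R : Type*} [DecidableEq I] [Fintype I] [CommMonoid R]
    (f : Fin n → I) (w : I → R) : ∏ k, w (f k) = ∏ i, w i ^ contentOf f i := by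
  rw [← Finset.prod_fiberwise univ f]
  refine prod_congr rfl fun i _ => ?_
  rw [contentOf, ← prod_const]
  exact prod_congr rfl fun k hk => by rw [(mem_filter.mp hk).2]

theorem sum_factorial_contentOf {K R : Type*} [DecidableEq K] [Fintype K] [CommRing R]
    (Φ : (K → ℕ) → R) :
    ∑ g : Fin n → K, ((∏ i, (contentOf g i).factorial : ℕ) : R) * Φ (contentOf g) =
      n.factorial * ∑ N ∈ piAntidiag univ n, Φ N := by
  -- Applying this functional to the two expansions of `(∑ X_i) ^ n` gives the identity: its weights
  -- `∏ N_i!` turn each multinomial coefficient into `n!`.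
  let L : MvPolynomial K R →ₗ[R] R := (MvPolynomial.basisMonomials K R).constr R
    fun N => ((∏ i, (N i).factorial : ℕ) : R) * Φ N
  have hL : ∀ N : K → ℕ, L (∏ i, MvPolynomial.X i ^ N i) =
      ((∏ i, (N i).factorial : ℕ) : R) * Φ N := fun N => by
    have h1 : (∏ i, MvPolynomial.X i ^ N i : MvPolynomial K R) =
        MvPolynomial.basisMonomials K R (Finsupp.equivFunOnFinite.symm N) := by
      rw [MvPolynomial.coe_basisMonomials]
      beta_reduce
      rw [MvPolynomial.monomial_eq, map_one, one_mul,
        Finsupp.prod_fintype _ _ (by simp)]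
      simp
    rw [h1, Module.Basis.constr_basis]
    simp
  have h1 : (∑ i : K, (MvPolynomial.X i : MvPolynomial K R)) ^ n =
      ∑ g : Fin n → K, ∏ i, MvPolynomial.X i ^ contentOf g i := by
    have := Finset.prod_univ_sum (fun _ : Fin n => (univ : Finset K))
      (fun _ i => (MvPolynomial.X i : MvPolynomial K R))
    simp only [prod_const, card_univ, Fintype.card_fin, Fintype.piFinset_univ] at this
    rw [this]
    exact sum_congr rfl fun g _ => prod_comp_eq_prod_pow_contentOf g _
  have h2 := congrArg L (h1.symm.trans (sum_pow_eq_sum_piAntidiag univ _ n))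
  rw [map_sum, map_sum] at h2
  simp only [hL] at h2
  rw [h2, mul_sum]
  refine sum_congr rfl fun N hN => ?_
  have hNs : ∑ i, N i = n := (mem_piAntidiag.mp hN).1
  rw [← nsmul_eq_mul, map_nsmul, hL, nsmul_eq_mul, ← mul_assoc, ← Nat.cast_mul, mul_comm
    (Nat.multinomial _ _), Nat.multinomial_spec, hNs]

theorem card_perm_comp_eq {I : Type*} [DecidableEq I] [Fintype I] (f : Fin n → I) :
    #{σ : Equiv.Perm (Fin n) | f ∘ σ = f} = ∏ i, (contentOf f i).factorial := by
  have := DomMulAct.stabilizer_card f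
  rw [Fintype.card_subtype] at this
  rw [this]
  refine prod_congr rfl fun i _ => ?_
  rw [Fintype.card_subtype, contentOf]

theorem sum_perm_sum_fixed {I R : Type*} [DecidableEq I] [Fintype I] [CommRing R]
    (F : (Fin n → I) → R) :
    ∑ σ : Equiv.Perm (Fin n), ∑ f : Fin n → I with f ∘ σ = f, F f =
      ∑ f, ((∏ i, (contentOf f i).factorial : ℕ) : R) * F f := by
  simp only [sum_filter]
  rw [sum_comm]
  refine sum_congr rfl fun f _ => ?_
  rw [← sum_filter, sum_const, nsmul_eq_mul, card_perm_comp_eq]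

/-- The power sum symmetric function `p_σ` of the cycle type of `σ`, in the variables `y`, as a
sum over the colorings that are constant on the cycles of `σ`. -/
def colorSum {J R : Type*} [DecidableEq J] [Fintype J] [CommRing R] (σ : Equiv.Perm (Fin n))
    (y : J → R) : R :=
  ∑ f : Fin n → J with f ∘ σ = f, ∏ k, y (f k)

/-- The number of colorings of content `α` that are constant on the cycles of `σ`. -/
def colorCount {I : Type*} [DecidableEq I] [Fintype I] (α : I → ℤ) (σ : Equiv.Perm (Fin n)) : ℤ :=
  #{f : Fin n → I | f ∘ σ = f ∧ ∀ i, (contentOf f i : ℤ) = α i}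

/-- The complete homogeneous symmetric functions, with index in `ℤ`. -/
def hSym {J R : Type*} [DecidableEq J] [Fintype J] [CommRing R] (y : J → R) (z : ℤ) : R :=
  if 0 ≤ z then ∑ N ∈ piAntidiag univ z.toNat, ∏ j, y j ^ N j else 0

theorem contentOf_fst {I J : Type*} [DecidableEq I] [DecidableEq J] [Fintype J]
    (g : Fin n → I × J) (i : I) :
    contentOf (fun k => (g k).1) i = ∑ j, contentOf g (i, j) := by
  rw [contentOf, card_eq_sum_card_fiberwise (f := fun k => (g k).2) (t := univ) (by simp)]
  refine sum_congr rfl fun j _ => ?_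
  rw [contentOf, filter_filter]
  simp [Prod.ext_iff]

/-- `N` is a matrix of naturals with prescribed row sums, so its rows vary independently. If some `α
i` is negative, both sides vanish. -/
theorem sum_piAntidiag_rows {I J R : Type*} [DecidableEq I] [Fintype I] [DecidableEq J]
    [Fintype J] [CommRing R] (y : J → R) (α : I → ℤ) (hα : ∑ i, α i = n) :
    ∑ N ∈ piAntidiag (univ : Finset (I × J)) n,
      (if ∀ i, ((∑ j, N (i, j) : ℕ) : ℤ) = α i then ∏ i, ∏ j, y j ^ N (i, j) else 0) =
      ∏ i, hSym y (α i) := by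
  by_cases hneg : ∃ i, α i < 0
  · obtain ⟨i, hi⟩ := hneg
    rw [prod_eq_zero (mem_univ i) (by rw [hSym, if_neg (by omega)])]
    refine sum_eq_zero fun N _ => if_neg fun h => ?_
    have := h i
    omega
  · push Not at hneg
    simp only [hSym, hneg, if_true]
    rw [prod_univ_sum, ← sum_filter]
    refine sum_nbij' (fun N i j => N (i, j)) (fun N x => N x.1 x.2) ?_ ?_ ?_ ?_ ?_
    · intro N hN
      simp only [mem_filter, Fintype.mem_piFinset, mem_piAntidiag] at hN ⊢
      intro i
      have := hN.2 i
      refine ⟨by omega, by simp⟩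
    · intro N hN
      simp only [mem_filter, Fintype.mem_piFinset, mem_piAntidiag] at hN ⊢
      refine ⟨⟨?_, by simp⟩, fun i => ?_⟩
      · rw [Fintype.sum_prod_type]
        simp only [(hN _).1]
        zify
        rw [← hα]
        exact sum_congr rfl fun i _ => Int.toNat_of_nonneg (hneg i)
      · rw [(hN i).1]
        exact Int.toNat_of_nonneg (hneg i)
    · intro N _; rfl
    · intro N _; rfl
    · intro N _; rfl

/-- A permutation character of a Young subgroup has a product of complete symmetric functions as its
characteristic. A pair of fixed colorings is one fixed coloring by `I × J`, and the factorials count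
its stabilizer. -/
theorem sum_colorCount_mul_colorSum {I J R : Type*} [DecidableEq I] [Fintype I] [DecidableEq J]
    [Fintype J] [CommRing R] (y : J → R) (α : I → ℤ) (hα : ∑ i, α i = n) :
    ∑ σ : Equiv.Perm (Fin n), (colorCount α σ : R) * colorSum σ y =
      n.factorial * ∏ i, hSym y (α i) := by
  rw [← sum_piAntidiag_rows y α hα, ← sum_factorial_contentOf, ← sum_perm_sum_fixed]
  refine sum_congr rfl fun σ _ => ?_
  rw [colorCount, colorSum, ← filter_filter, card_filter]
  push_cast
  rw [sum_mul_sum, ← sum_product']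
  refine sum_nbij' (fun p k => (p.1 k, p.2 k)) (fun g => (fun k => (g k).1, fun k => (g k).2))
    ?_ ?_ ?_ ?_ ?_
  · rintro ⟨f, f'⟩ h
    simp only [mem_product, mem_filter, mem_univ, true_and, funext_iff, Function.comp_apply] at h ⊢
    intro k
    rw [h.1, h.2]
  · intro g h
    simp only [mem_product, mem_filter, mem_univ, true_and, funext_iff, Function.comp_apply] at h ⊢
    exact ⟨fun k => by rw [h], fun k => by rw [h]⟩
  · intro p _; rfl
  · intro g _; rfl
  · rintro ⟨f, f'⟩ _
    have h1 : ∀ i, ∑ j, (contentOf (fun k => (f k, f' k)) (i, j) : ℤ) = contentOf f i := fun i =>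
      mod_cast (contentOf_fst (fun k => (f k, f' k)) i).symm
    have h2 : ∏ k, y (f' k) = ∏ i, ∏ j, y j ^ contentOf (fun k => (f k, f' k)) (i, j) := by
      rw [← Fintype.prod_prod_type' (fun i j => y j ^ contentOf (fun k => (f k, f' k)) (i, j)),
        ← prod_comp_eq_prod_pow_contentOf (fun k => (f k, f' k)) (fun x => y x.2)]
    simp only [h1, ← h2]
    split_ifs <;> simp

/-! ### The Jacobi-Trudi identity -/

theorem hSym_natCast {J R : Type*} [DecidableEq J] [Fintype J] [CommRing R] (y : J → R) (d : ℕ) :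
    hSym y d = PowerSeries.coeff d (∏ j, PowerSeries.mk fun e => y j ^ e) := by
  rw [PowerSeries.coeff_prod, hSym, if_pos (by omega), Int.toNat_natCast]
  refine sum_nbij' (fun N => Finsupp.equivFunOnFinite.symm N) (fun N => N) ?_ ?_ ?_ ?_ ?_
  · intro N hN
    simp only [mem_piAntidiag, mem_finsuppAntidiag] at hN ⊢
    exact ⟨by simpa using hN.1, by simp⟩
  · intro N hN
    simp only [mem_piAntidiag, mem_finsuppAntidiag] at hN ⊢
    exact ⟨hN.1, by simp⟩
  · intro N _; rfl
  · intro N _; ext; rfl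
  · intro N _; simp

variable {m : ℕ}

/-- The coefficients of `∏_{r ≠ k} (1 - y_r z)`. -/
noncomputable def elemPoly {R : Type*} [CommRing R] (y : Fin m → R) (k : Fin m) : Polynomial R :=
  ∏ r ∈ univ.erase k, (1 - Polynomial.C (y r) * Polynomial.X)

theorem natDegree_elemPoly_lt {R : Type*} [CommRing R] (y : Fin m → R) (k : Fin m) :
    (elemPoly y k).natDegree < m := by
  have h : (elemPoly y k).natDegree ≤ ∑ r ∈ univ.erase k, 1 := by
    refine (Polynomial.natDegree_prod_le _ _).trans (sum_le_sum fun r _ => ?_)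
    refine (Polynomial.natDegree_sub_le _ _).trans ?_
    simp only [Polynomial.natDegree_one, zero_le, sup_of_le_right]
    exact (Polynomial.natDegree_C_mul_le _ _).trans Polynomial.natDegree_X_le
  simp only [sum_const, card_erase_of_mem (mem_univ k), card_univ, Fintype.card_fin, smul_eq_mul,
    mul_one] at h
  have := k.pos
  omega

/-- The factors `1 - y_r z` with `r ≠ k` cancel every geometric series except the one of `y_k`. -/
theorem elemPoly_mul_prod {R : Type*} [CommRing R] (y : Fin m → R) (k : Fin m) :
    (elemPoly y k : PowerSeries R) * ∏ j, (PowerSeries.mk fun e => y j ^ e) =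
      PowerSeries.mk fun e => y k ^ e := by
  have h : ∀ a : R, (1 - PowerSeries.C a * PowerSeries.X) * (PowerSeries.mk fun e => a ^ e) = 1 := by
    intro a
    ext d
    rw [sub_mul, one_mul, mul_assoc, map_sub, PowerSeries.coeff_C_mul, PowerSeries.coeff_mk]
    cases d with
    | zero => simp
    | succ d => simp [PowerSeries.coeff_succ_X_mul, PowerSeries.coeff_one, pow_succ', sub_self]
  rw [← mul_prod_erase univ _ (mem_univ k), mul_left_comm]
  have h2 : (elemPoly y k : PowerSeries R) =
      ∏ r ∈ univ.erase k, (1 - PowerSeries.C (y r) * PowerSeries.X) := by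
    rw [elemPoly, ← Polynomial.coeToPowerSeries.ringHom_apply, map_prod]
    simp
  rw [h2, ← prod_mul_distrib, prod_congr rfl fun r _ => h (y r), prod_const_one, mul_one]

theorem sum_hSym_mul_coeff_elemPoly {R : Type*} [CommRing R] (y : Fin m → R) (k : Fin m) (d : ℕ) :
    ∑ j : Fin m, hSym y ((d : ℤ) - (j.rev : ℕ)) * (elemPoly y k).coeff (j.rev : ℕ) = y k ^ d := by
  have h := congrArg (PowerSeries.coeff d) (elemPoly_mul_prod y k)
  rw [PowerSeries.coeff_mk, PowerSeries.coeff_mul] at h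
  rw [← h]
  refine (Equiv.sum_comp Fin.revPerm
    (fun j : Fin m => hSym y ((d : ℤ) - (j : ℕ)) * (elemPoly y k).coeff (j : ℕ))).trans ?_
  rw [Fin.sum_univ_eq_sum_range (fun j => hSym y ((d : ℤ) - j) * (elemPoly y k).coeff j),
    Nat.sum_antidiagonal_eq_sum_range_succ
      (fun a b => PowerSeries.coeff a (elemPoly y k : PowerSeries R) *
        PowerSeries.coeff b (∏ j, PowerSeries.mk fun e => y j ^ e))]
  have h1 : ∀ N, m ≤ N → ∑ j ∈ range m, hSym y ((d : ℤ) - j) * (elemPoly y k).coeff j =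
      ∑ j ∈ range N, hSym y ((d : ℤ) - j) * (elemPoly y k).coeff j := fun N hN => by
    refine sum_subset (range_subset_range.mpr hN) fun j _ hj => ?_
    rw [mem_range, not_lt] at hj
    rw [Polynomial.coeff_eq_zero_of_natDegree_lt ((natDegree_elemPoly_lt y k).trans_le hj),
      mul_zero]
  -- Both sums are padded to a common range: beyond `m` the polynomial coefficients vanish, and
  -- beyond `d` the index of `hSym` is negative.
  rw [h1 (m + (d + 1)) (by omega)]
  symm
  have h2 : range (d + 1) ⊆ range (m + (d + 1)) := range_subset_range.mpr (by omega)
  rw [← sum_subset h2 (f := fun j : ℕ => hSym y ((d : ℤ) - j) * (elemPoly y k).coeff j)]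
  · refine sum_congr rfl fun j hj => ?_
    rw [mem_range] at hj
    rw [← hSym_natCast, Polynomial.coeff_coe, mul_comm]
    congr 2
    omega
  · intro j _ hj
    rw [mem_range] at hj
    rw [hSym, if_neg (by omega), zero_mul]

theorem hSym_zero {J R : Type*} [DecidableEq J] [Fintype J] [CommRing R] (y : J → R) :
    hSym y 0 = 1 := by
  simp [hSym]

/-- The matrix of complete functions times one fixed matrix of signed elementary functions is `(y_k
^ l_i)`. For `l = δ = (m - 1, …, 0)` the first factor is unitriangular, so the fixed matrix has the
alternant of δ as its determinant. -/
theorem det_hSym_mul_alternant {R : Type*} [CommRing R] (y : Fin m → R) (l : Fin m → ℕ) :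
    (Matrix.of fun i j : Fin m => hSym y ((l i : ℤ) - (j.rev : ℕ))).det *
      (Matrix.of fun i k : Fin m => y k ^ (i.rev : ℕ)).det =
      (Matrix.of fun i k : Fin m => y k ^ l i).det := by
  have h : ∀ l : Fin m → ℕ, (Matrix.of fun i j : Fin m => hSym y ((l i : ℤ) - (j.rev : ℕ))) *
      (Matrix.of fun j k : Fin m => (elemPoly y k).coeff (j.rev : ℕ)) =
      (Matrix.of fun i k : Fin m => y k ^ l i) := fun l => by
    ext i k
    simp only [Matrix.mul_apply, Matrix.of_apply]
    exact sum_hSym_mul_coeff_elemPoly y k (l i)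
  have h0 := congrArg Matrix.det (h fun i => i.rev)
  rw [Matrix.det_mul, Matrix.det_of_isUpperTriangular] at h0
  · simp only [Matrix.of_apply, sub_self, hSym_zero, prod_const_one, one_mul] at h0
    rw [← h0, ← h l, Matrix.det_mul]
  · intro i j hij
    simp only [id_eq] at hij
    rw [Matrix.of_apply, hSym, if_neg]
    have : (i.rev : ℕ) < j.rev := Fin.rev_lt_rev.mpr hij
    omega

/-- The class function `∑_π sgn(π) ψ_{l - δ ∘ π}`. -/
def frobFun (l : Fin m → ℕ) (σ : Equiv.Perm (Fin n)) : ℤ :=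
  ∑ π : Equiv.Perm (Fin m), sgn ℤ π * colorCount (fun k => (l k : ℤ) - ((π k).rev : ℕ)) σ

theorem sum_sub_rev_perm (l : Fin m → ℕ) (hl : ∑ k, l k = n + ∑ k : Fin m, (k.rev : ℕ))
    (π : Equiv.Perm (Fin m)) : ∑ k, ((l k : ℤ) - ((π k).rev : ℕ)) = n := by
  rw [sum_sub_distrib, Equiv.sum_comp π (fun k : Fin m => (((k.rev : ℕ)) : ℤ)),
    ← Nat.cast_sum, hl]
  push_cast
  ring

/-- The Frobenius formula for the class function `frobFun l`. -/
theorem sum_frobFun_mul_colorSum {R : Type*} [CommRing R] (y : Fin m → R) (l : Fin m → ℕ)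
    (hl : ∑ k, l k = n + ∑ k : Fin m, (k.rev : ℕ)) :
    (∑ σ : Equiv.Perm (Fin n), (frobFun l σ : R) * colorSum σ y) *
      (Matrix.of fun i k : Fin m => y k ^ (i.rev : ℕ)).det =
      n.factorial * (Matrix.of fun i k : Fin m => y k ^ l i).det := by
  rw [← det_hSym_mul_alternant y l, ← mul_assoc]
  congr 1
  rw [← Matrix.det_transpose, Matrix.det_apply', mul_sum]
  simp only [frobFun, Int.cast_sum, Int.cast_mul, sum_mul]
  rw [sum_comm]
  refine sum_congr rfl fun π _ => ?_
  simp only [mul_assoc]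
  rw [← mul_sum, sum_colorCount_mul_colorSum y _ (sum_sub_rev_perm l hl π), mul_left_comm]
  simp [sgn]

theorem prod_X_pow_eq_monomial (R : Type*) [CommRing R] (e : Fin m → ℕ) :
    ∏ k, (MvPolynomial.X k : MvPolynomial (Fin m) R) ^ e k =
      MvPolynomial.monomial (Finsupp.equivFunOnFinite.symm e) 1 := by
  rw [MvPolynomial.monomial_eq, map_one, one_mul, Finsupp.prod_fintype _ _ (by simp)]
  simp

theorem det_X_pow (e : Fin m → ℕ) :
    (Matrix.of fun i k : Fin m => (MvPolynomial.X k : MvPolynomial (Fin m) ℤ) ^ e i).det =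
      ∑ π : Equiv.Perm (Fin m),
        MvPolynomial.monomial (Finsupp.equivFunOnFinite.symm fun k => e (π k)) (sgn ℤ π) := by
  rw [Matrix.det_apply']
  refine sum_congr rfl fun π _ => ?_
  simp only [Matrix.of_apply, prod_X_pow_eq_monomial]
  rw [← mul_one (sgn ℤ π), ← MvPolynomial.C_mul_monomial]
  simp [sgn]

/-- In Frobenius' formula with indeterminates `y`, compare the coefficients of `y ^ l`. In the color
sum of `σ` times the alternant of δ it is again `frobFun l σ`; on the right only the identity
contributes, as the `l k` are distinct. -/
theorem sum_frobFun_sq (l : Fin m → ℕ) (hl : ∑ k, l k = n + ∑ k : Fin m, (k.rev : ℕ))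
    (hinj : Function.Injective l) :
    ∑ σ : Equiv.Perm (Fin n), frobFun l σ * frobFun l σ = n.factorial := by
  have h := congrArg (MvPolynomial.coeff (Finsupp.equivFunOnFinite.symm l))
    (sum_frobFun_mul_colorSum (R := MvPolynomial (Fin m) ℤ) MvPolynomial.X l hl)
  rw [det_X_pow, det_X_pow, sum_mul, MvPolynomial.coeff_sum] at h
  have h1 : ∀ σ : Equiv.Perm (Fin n), MvPolynomial.coeff (Finsupp.equivFunOnFinite.symm l)
      ((frobFun l σ : MvPolynomial (Fin m) ℤ) * colorSum σ MvPolynomial.X *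
        ∑ π : Equiv.Perm (Fin m), MvPolynomial.monomial
          (Finsupp.equivFunOnFinite.symm fun k => ((π k).rev : ℕ)) (sgn ℤ π)) =
      frobFun l σ * frobFun l σ := fun σ => by
    have e1 : (frobFun l σ : MvPolynomial (Fin m) ℤ) = MvPolynomial.C (frobFun l σ) := by simp
    rw [e1, mul_assoc, MvPolynomial.coeff_C_mul]
    congr 1
    rw [colorSum, sum_mul_sum, MvPolynomial.coeff_sum]
    simp only [MvPolynomial.coeff_sum]
    rw [sum_comm, frobFun]
    refine sum_congr rfl fun π _ => ?_
    simp only [prod_comp_eq_prod_pow_contentOf, prod_X_pow_eq_monomial, MvPolynomial.monomial_mul,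
      one_mul, MvPolynomial.coeff_monomial]
    rw [colorCount, ← sum_filter, filter_filter, sum_const, nsmul_eq_mul, mul_comm]
    congr 3
    ext f
    simp only [mem_filter, mem_univ, true_and, Finsupp.ext_iff, Finsupp.add_apply,
      Finsupp.equivFunOnFinite_symm_apply_apply]
    refine and_congr_right fun _ => forall_congr' fun i => ?_
    omega
  rw [sum_congr rfl fun σ _ => h1 σ] at h
  rw [h]
  have e2 : (n.factorial : MvPolynomial (Fin m) ℤ) = MvPolynomial.C (n.factorial : ℤ) := by simp
  rw [e2, MvPolynomial.coeff_C_mul, MvPolynomial.coeff_sum, Fintype.sum_eq_single 1]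
  · simp [sgn_one]
  · intro π hπ
    rw [MvPolynomial.coeff_monomial, if_neg]
    intro h
    refine hπ (Equiv.ext fun k => hinj ?_)
    have := DFunLike.congr_fun h k
    simpa using this

theorem colorCount_conj {I : Type*} [DecidableEq I] [Fintype I] (α : I → ℤ)
    (g σ : Equiv.Perm (Fin n)) : colorCount α (g * σ * g⁻¹) = colorCount α σ := by
  rw [colorCount, colorCount, Nat.cast_inj]
  refine card_equiv (Equiv.arrowCongr g⁻¹ (Equiv.refl _)) fun f => ?_
  have h1 : ∀ i, contentOf (f ∘ g) i = contentOf f i := fun i => by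
    rw [contentOf, contentOf]
    exact card_equiv g (by simp)
  have h2 : (Equiv.arrowCongr g⁻¹ (Equiv.refl I)) f = f ∘ g := rfl
  simp only [h2, mem_filter, mem_univ, true_and, h1]
  refine and_congr_left fun _ => ?_
  simp only [funext_iff, Function.comp_apply, Equiv.Perm.mul_apply]
  constructor
  · intro h k
    have := h (g k)
    simpa using this
  · intro h k
    have := h (g⁻¹ k)
    simpa using this

theorem frobFun_conj (l : Fin m → ℕ) (g σ : Equiv.Perm (Fin n)) :
    frobFun l (g * σ * g⁻¹) = frobFun l σ := by
  simp only [frobFun, colorCount_conj]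

end ColorSum

/-! ### Frobenius' formula for the Specht character. -/

section Comparison

open Finset MonoidAlgebra

variable {n m : ℕ} {lam : YoungDiagram}

/-- The signed number of pairs (row permutation, column permutation) whose product fixes the
coloring `f`. -/
noncomputable def signedStab (T : lam.cells ≃ Fin n) (f : Fin n → Fin m) : ℂ :=
  ∑ p : rowGroup T, ∑ q : colGroup T,
    if f ∘ (p * q : Equiv.Perm (Fin n)) = f then sgn ℂ (q : Equiv.Perm (Fin n)) else 0

theorem sum_youngSymmetrizer_coeff_mul_colorCount (T : lam.cells ≃ Fin n) (α : Fin m → ℤ) :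
    ∑ τ, (youngSymmetrizer T).coeff τ * (colorCount α τ : ℂ) =
      ∑ f : Fin n → Fin m with ∀ i, (contentOf f i : ℤ) = α i, signedStab T f := by
  rw [sum_youngSymmetrizer_coeff_mul]
  simp only [colorCount, signedStab, Int.cast_natCast]
  symm
  rw [sum_comm]
  refine sum_congr rfl fun p _ => ?_
  rw [sum_comm]
  refine sum_congr rfl fun q _ => ?_
  rw [← sum_filter, filter_filter, sum_const, nsmul_eq_mul, mul_comm]
  congr 3
  ext f
  simp only [mem_filter, mem_univ, true_and, and_comm]

/-- The transposition of `x` and `y` fixes `f` and lies in the column group, so multiplying `q` by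
it reverses the sign of every term. -/
theorem signedStab_eq_zero (T : lam.cells ≃ Fin n) (f : Fin n → Fin m) {x y : Fin n}
    (hxy : x ≠ y) (hc : (T.symm x).1.2 = (T.symm y).1.2) (hf : f x = f y) :
    signedStab T f = 0 := by
  have ht : f ∘ Equiv.swap x y = f := by
    funext z
    by_cases hx : z = x
    · subst hx; simp [hf]
    · by_cases hy : z = y
      · subst hy; simp [hf]
      · rw [Function.comp_apply, Equiv.swap_apply_of_ne_of_ne hx hy]
  refine sum_eq_zero fun p _ => ?_
  rw [← self_eq_neg, ← sum_neg_distrib]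
  refine Fintype.sum_equiv (Equiv.mulRight ⟨_, swap_mem_colGroup hc⟩) _ _ fun q => ?_
  have h : f ∘ (p * (q * Equiv.swap x y) : Equiv.Perm (Fin n)) = f ↔
      f ∘ (p * q : Equiv.Perm (Fin n)) = f := by
    rw [← mul_assoc, Equiv.Perm.coe_mul _ (Equiv.swap x y), ← Function.comp_assoc]
    constructor
    · intro h
      funext z
      have h1 := congrFun h (Equiv.swap x y z)
      have h2 := congrFun ht z
      rw [Function.comp_apply] at h1 h2
      rwa [h2, ← Equiv.Perm.mul_apply, Equiv.swap_mul_self, Equiv.Perm.one_apply] at h1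
    · intro h
      rw [h, ht]
  simp only [Equiv.coe_mulRight, Subgroup.coe_mul, h, sgn_mul, sgn_swap ℂ hxy]
  split_ifs <;> simp

theorem card_filter_val_lt (f : Fin n → Fin m) (k : ℕ) :
    #{x | (f x : ℕ) < k} = ∑ i ∈ univ.filter (fun i : Fin m => (i : ℕ) < k), contentOf f i := by
  rw [card_eq_sum_card_fiberwise (f := f) (t := univ.filter fun i : Fin m => (i : ℕ) < k)
    (by intro x; simp)]
  refine sum_congr rfl fun i hi => ?_
  rw [contentOf, filter_filter]
  congr 1
  ext x
  simp only [mem_filter, mem_univ, true_and, and_iff_right_iff_imp] at hi ⊢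
  rintro rfl
  exact hi

/-- Once all smaller indices are fixed, the partial sum gives `π i ≤ i`, and injectivity excludes `π
i < i`. -/
theorem perm_eq_one_of_sum_le (π : Equiv.Perm (Fin m))
    (h : ∀ k : ℕ, ∑ i ∈ univ.filter (fun i : Fin m => (i : ℕ) < k), ((π i : ℕ) : ℤ) ≤
      ∑ i ∈ univ.filter (fun i : Fin m => (i : ℕ) < k), ((i : ℕ) : ℤ)) : π = 1 := by
  have key : ∀ d : ℕ, ∀ i : Fin m, (i : ℕ) = d → π i = i := by
    intro d
    induction d using Nat.strong_induction_on with
    | _ d ih =>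
      intro i hi
      have hins : (univ.filter fun j : Fin m => (j : ℕ) < d + 1) =
          insert i (univ.filter fun j : Fin m => (j : ℕ) < d) := by
        ext j
        simp only [mem_filter, mem_univ, true_and, mem_insert, Fin.ext_iff]
        omega
      have hd := h (d + 1)
      have hni : i ∉ univ.filter fun j : Fin m => (j : ℕ) < d := by simp [hi]
      rw [hins, sum_insert hni, sum_insert hni] at hd
      have hs : ∑ j ∈ univ.filter (fun j : Fin m => (j : ℕ) < d), ((π j : ℕ) : ℤ) =
          ∑ j ∈ univ.filter (fun j : Fin m => (j : ℕ) < d), ((j : ℕ) : ℤ) :=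
        sum_congr rfl fun j hj => by rw [ih j (mem_filter.mp hj).2 j rfl]
      rw [hs] at hd
      by_contra hne
      have hlt : (π i : ℕ) < d := by
        have : (π i : ℕ) ≠ i := fun hh => hne (Fin.ext hh)
        omega
      exact hne (π.injective (ih _ hlt _ rfl))
  exact Equiv.ext fun i => key i i rfl

/-- The filling of the diagram by row numbers. -/
def rowFilling (T : lam.cells ≃ Fin n) (hm : lam.colLen 0 ≤ m) (x : Fin n) : Fin m :=
  ⟨(T.symm x).1.1, by
    have h := (T.symm x).2
    rw [YoungDiagram.mem_cells, YoungDiagram.mem_iff_lt_colLen] at h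
    exact h.trans_le ((lam.colLen_anti 0 _ (Nat.zero_le _)).trans hm)⟩

theorem contentOf_rowFilling (T : lam.cells ≃ Fin n) (hm : lam.colLen 0 ≤ m) (i : Fin m) :
    contentOf (rowFilling T hm) i = lam.rowLen i := by
  rw [← card_filter_row_eq T, contentOf]
  simp [rowFilling, Fin.ext_iff]

/-- The parts of `lam` (padded to `m` parts), shifted by `m - 1, …, 1, 0`. -/
def shiftedPart (lam : YoungDiagram) (m : ℕ) (k : Fin m) : ℕ := lam.rowLen k + (k.rev : ℕ)

theorem shiftedPart_injective (lam : YoungDiagram) (m : ℕ) :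
    Function.Injective (shiftedPart lam m) := by
  have h : StrictAnti (shiftedPart lam m) := fun i j hij => by
    have h1 := lam.rowLen_anti _ _ (Fin.le_def.mp hij.le)
    have h2 := Fin.lt_def.mp hij
    simp only [shiftedPart, Fin.val_rev]
    omega
  exact h.injective

theorem sum_rowLen (T : lam.cells ≃ Fin n) (hm : lam.colLen 0 ≤ m) :
    ∑ k : Fin m, lam.rowLen k = n := by
  simp only [← contentOf_rowFilling T hm, contentOf]
  rw [← card_eq_sum_card_fiberwise (f := rowFilling T hm) (t := univ) (by simp)]
  simp

theorem sum_shiftedPart (T : lam.cells ≃ Fin n) (hm : lam.colLen 0 ≤ m) :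
    ∑ k, shiftedPart lam m k = n + ∑ k : Fin m, (k.rev : ℕ) := by
  simp only [shiftedPart, sum_add_distrib, sum_rowLen T hm]

/-- A coloring with nonzero contribution is injective on columns, so its content `λ_i + π i - i` is
dominated by λ. The partial sums of `π i` are then at most those of `i`, which forces `π = 1`. -/
theorem sum_signedStab_eq_zero (T : lam.cells ≃ Fin n) (hm : lam.colLen 0 ≤ m)
    (π : Equiv.Perm (Fin m)) (hπ : π ≠ 1) :
    ∑ f : Fin n → Fin m with
      ∀ i : Fin m, (contentOf f i : ℤ) = (shiftedPart lam m i : ℤ) - ((π i).rev : ℕ), signedStab T f = 0 := by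
  refine sum_eq_zero fun f hf => ?_
  by_contra h0
  have hinj : ∀ x y, (T.symm x).1.2 = (T.symm y).1.2 → (f x : ℕ) = f y → x = y := by
    intro x y hc hxy
    by_contra hne
    exact h0 (signedStab_eq_zero T f hne hc (Fin.ext hxy))
  refine hπ (perm_eq_one_of_sum_le π fun k => ?_)
  have h := card_filter_lt_le_of_colInjective T (fun x => (f x : ℕ)) hinj k
  have h' : #{x | (T.symm x).1.1 < k} = #{x | (rowFilling T hm x : ℕ) < k} := rfl
  rw [h', card_filter_val_lt, card_filter_val_lt] at h
  rw [← Nat.cast_le (α := ℤ), Nat.cast_sum, Nat.cast_sum] at h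
  simp only [(mem_filter.mp hf).2, contentOf_rowFilling, shiftedPart] at h
  rw [← sub_nonneg, ← sum_sub_distrib] at h ⊢
  refine h.trans_eq (sum_congr rfl fun i _ => ?_)
  have := i.2
  have := (π i).2
  push_cast [Fin.val_rev]
  omega

theorem signedStab_rowFilling_comp (T : lam.cells ≃ Fin n) (hm : lam.colLen 0 ≤ m)
    (r : Equiv.Perm (Fin n)) :
    signedStab T (rowFilling T hm ∘ r) = open Classical in
      ∑ p : rowGroup T, ∑ q : colGroup T,
        if r * p * q * r⁻¹ ∈ rowGroup T then sgn ℂ (q : Equiv.Perm (Fin n)) else 0 := by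
  classical
  refine sum_congr rfl fun p _ => sum_congr rfl fun q _ => ?_
  congr 1
  rw [eq_iff_iff, mem_rowGroup, funext_iff]
  constructor
  · intro h x
    have := congrArg Fin.val (h (r⁻¹ x))
    simpa [rowFilling] using this
  · intro h x
    have := h (r x)
    exact Fin.ext (by simpa [rowFilling] using this)

theorem youngScalar_eq_triple_sum (T : lam.cells ≃ Fin n) :
    youngScalar T = open Classical in
      ∑ r : colGroup T, ∑ p : rowGroup T, ∑ q : colGroup T,
        if (r * p * q : Equiv.Perm (Fin n)) ∈ rowGroup T then
          sgn ℂ (r : Equiv.Perm (Fin n)) * sgn ℂ (q : Equiv.Perm (Fin n)) else 0 := by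
  classical
  rw [youngScalar_eq_sum, sum_youngSymmetrizer_coeff_mul T (fun τ => (youngSymmetrizer T).coeff τ⁻¹),
    sum_comm]
  refine sum_congr rfl fun r _ => ?_
  simp only [youngSymmetrizer_coeff, mul_sum]
  rw [sum_comm]
  refine sum_congr rfl fun p _ => ?_
  rw [sum_comm]
  refine sum_congr rfl fun q _ => ?_
  by_cases h : (r * p * q : Equiv.Perm (Fin n)) ∈ rowGroup T
  · rw [if_pos h, Fintype.sum_eq_single (⟨_, h⟩⁻¹ : rowGroup T)]
    · rw [if_pos]
      simp [mul_assoc]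
    · intro p' hp'
      rw [if_neg, mul_zero]
      intro hh
      refine hp' (Subtype.ext ?_)
      simp only [InvMemClass.coe_inv]
      rw [mul_assoc, hh]
      simp
  · rw [if_neg h]
    refine sum_eq_zero fun p' _ => ?_
    rw [if_neg, mul_zero]
    intro hh
    rw [mul_assoc, hh] at h
    exact h (by simp)

/-- The column-injective colorings of content λ are the row filling composed with column
permutations `r`, each arising once. Substituting `q ↦ q r⁻¹` matches their contributions with the
triple sum for κ. -/
theorem sum_signedStab_one (T : lam.cells ≃ Fin n) (hm : lam.colLen 0 ≤ m) :
    ∑ f : Fin n → Fin m with ∀ i : Fin m, (contentOf f i : ℤ) = lam.rowLen i, signedStab T f =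
      youngScalar T := by
  classical
  have hsub : ∑ f : Fin n → Fin m with ∀ i : Fin m, (contentOf f i : ℤ) = lam.rowLen i, signedStab T f =
      ∑ r : colGroup T, signedStab T (rowFilling T hm ∘ (r : Equiv.Perm (Fin n))) := by
    rw [← sum_image (s := (univ : Finset (colGroup T)))
      (g := fun r => rowFilling T hm ∘ (r : Equiv.Perm (Fin n))) (f := signedStab T)]
    · symm
      refine sum_subset ?_ ?_
      · intro f hf
        simp only [mem_image, mem_univ, true_and] at hf
        obtain ⟨r, rfl⟩ := hf
        simp only [mem_filter, mem_univ, true_and, ← contentOf_rowFilling T hm, Nat.cast_inj]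
        intro i
        exact card_equiv (r : Equiv.Perm (Fin n)) (by simp)
      · intro f hf hf'
        by_contra h0
        have hinj : ∀ x y, (T.symm x).1.2 = (T.symm y).1.2 → (f x : ℕ) = f y → x = y := by
          intro x y hc hxy
          by_contra hne
          exact h0 (signedStab_eq_zero T f hne hc (Fin.ext hxy))
        simp only [mem_filter, mem_univ, true_and, Nat.cast_inj] at hf
        obtain ⟨q, hq, hfq⟩ := exists_colPerm_of_colInjective T (fun x => (f x : ℕ)) hinj
          (fun k => by
            have h' : #{x | (T.symm x).1.1 < k} = #{x | (rowFilling T hm x : ℕ) < k} := rfl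
            rw [h', card_filter_val_lt, card_filter_val_lt]
            simp only [hf, contentOf_rowFilling])
        refine hf' (mem_image.mpr ⟨⟨q, hq⟩, mem_univ _, ?_⟩)
        funext x
        exact Fin.ext (hfq x).symm
    · intro r _ r' _ h
      refine Subtype.ext (Equiv.ext fun x => T.symm.injective (Subtype.ext (Prod.ext ?_ ?_)))
      · exact congrArg Fin.val (congrFun h x)
      · exact (r.2 x).trans (r'.2 x).symm
  rw [hsub, youngScalar_eq_triple_sum]
  refine sum_congr rfl fun r _ => ?_
  rw [signedStab_rowFilling_comp]
  refine sum_congr rfl fun p _ => ?_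
  refine Fintype.sum_equiv (Equiv.mulRight r⁻¹) _ _ fun q => ?_
  simp only [Equiv.coe_mulRight, Subgroup.coe_mul, InvMemClass.coe_inv, sgn_mul, sgn_inv,
    mul_assoc]
  rw [mul_left_comm, sgn_mul_self, mul_one]

theorem sum_youngSymmetrizer_coeff_mul_frobFun (T : lam.cells ≃ Fin n) (hm : lam.colLen 0 ≤ m) :
    ∑ τ, (youngSymmetrizer T).coeff τ * (frobFun (shiftedPart lam m) τ : ℂ) = youngScalar T := by
  simp only [frobFun, Int.cast_sum, Int.cast_mul, mul_sum]
  rw [sum_comm]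
  simp only [mul_left_comm _ ((sgn ℤ _ : ℤ) : ℂ), ← mul_sum,
    sum_youngSymmetrizer_coeff_mul_colorCount]
  rw [Fintype.sum_eq_single 1]
  · rw [sgn_one, Int.cast_one, one_mul, ← sum_signedStab_one T hm]
    congr 1
    ext f
    simp [shiftedPart]
  · intro π hπ
    rw [sum_signedStab_eq_zero T hm π hπ, mul_zero]

/-- Frobenius' formula: the character of the Specht module. -/
theorem spechtRep_character_eq_frobFun (T : lam.cells ≃ Fin n) (hm : lam.colLen 0 ≤ m)
    (σ : Equiv.Perm (Fin n)) :
    (spechtRep T).character σ = frobFun (shiftedPart lam m) σ := by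
  set χ := (spechtRep T).character with hχ
  set ω : Equiv.Perm (Fin n) → ℂ := fun σ => (frobFun (shiftedPart lam m) σ : ℂ) with hω
  have hωc : ∀ g σ, ω (g * σ * g⁻¹) = ω σ := fun g σ => by simp only [hω, frobFun_conj]
  have hχinv := class_fun_inv χ (spechtRep_character_conj T)
  have hωinv := class_fun_inv ω hωc
  have h1 : ∑ σ, χ σ * χ σ = n.factorial := by
    rw [← sum_spechtRep_character_mul_inv T]
    exact sum_congr rfl fun σ _ => by rw [← hχ, hχinv]
  have h2 : ∑ σ, χ σ * ω σ = n.factorial := by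
    have h := youngScalar_mul_sum_character_mul T ω hωc
    rw [sum_youngSymmetrizer_coeff_mul_frobFun T hm, mul_comm (n.factorial : ℂ)] at h
    rw [← mul_left_cancel₀ (youngScalar_ne_zero T) h]
    exact sum_congr rfl fun σ _ => by rw [hωinv]
  have h3 : ∑ σ, ω σ * ω σ = n.factorial := by
    have h := sum_frobFun_sq (shiftedPart lam m) (sum_shiftedPart T hm) (shiftedPart_injective lam m)
    simp only [hω]
    exact_mod_cast h
  -- All three pairings of χ and ω equal `n!`, and since both are real, a vanishing sum of squares
  -- makes them equal pointwise.
  have h4 : ∑ σ, (χ σ - ω σ) * (χ σ - ω σ) = 0 := by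
    have : ∀ σ, (χ σ - ω σ) * (χ σ - ω σ) = χ σ * χ σ - 2 * (χ σ * ω σ) + ω σ * ω σ :=
      fun σ => by ring
    simp only [this, sum_add_distrib, sum_sub_distrib, ← mul_sum, h1, h2, h3]
    ring
  choose r hr using exists_ofReal_eq_spechtRep_character T
  have h5 : ∀ σ, χ σ - ω σ = ((r σ - (frobFun (shiftedPart lam m) σ : ℝ) : ℝ) : ℂ) := fun σ => by
    rw [hχ, hr]; push_cast; rfl
  simp only [h5, ← Complex.ofReal_mul, ← Complex.ofReal_sum, Complex.ofReal_eq_zero] at h4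
  have h6 := (sum_eq_zero_iff_of_nonneg fun σ _ => mul_self_nonneg _).mp h4 σ (mem_univ _)
  have h7 := h5 σ
  rw [mul_self_eq_zero.mp h6, Complex.ofReal_zero] at h7
  exact sub_eq_zero.mp h7

end Comparison

/-! ### Cycles of a permutation and determinants of monomial matrices. -/

section Cycles

open Finset

theorem comp_eq_of_sameCycle {α β : Type*} [Finite α] {σ : Equiv.Perm α} {f : α → β}
    (hf : f ∘ σ = f) {x y : α} (h : σ.SameCycle x y) : f x = f y := by
  obtain ⟨i, rfl⟩ := h.exists_nat_pow_eq
  induction i with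
  | zero => rfl
  | succ i ih =>
    rw [ih (Equiv.Perm.sameCycle_pow_right.mpr (Equiv.Perm.SameCycle.refl _ _)), pow_succ',
      Equiv.Perm.mul_apply]
    exact (congrFun hf _).symm

/-- In the Leibniz expansion a nonzero term sends each `i` to `i` or `τ i`. One step along `τ`
forces the next by injectivity, so only 1 and `τ` survive; they coincide for a single point, which
is treated separately. -/
theorem det_one_sub_transitive {ι R : Type*} [Fintype ι] [DecidableEq ι] [Nonempty ι] [CommRing R]
    (τ : Equiv.Perm ι) (hτ : ∀ i j, τ.SameCycle i j) (x : ι → R) :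
    (1 - Matrix.of fun i j => if i = τ j then x i else 0 : Matrix ι ι R).det = 1 - ∏ i, x i := by
  rcases subsingleton_or_nontrivial ι with hs | hs
  · obtain ⟨i0⟩ := ‹Nonempty ι›
    let _ : Unique ι := ⟨⟨i0⟩, fun a => Subsingleton.elim _ _⟩
    rw [Matrix.det_unique]
    simp [Subsingleton.elim (τ default) default]
  · have hfix : ∀ i, τ i ≠ i := by
      intro i hi
      obtain ⟨j, hj⟩ := exists_ne i
      exact hj ((hτ i j).eq_of_left hi).symm
    have hcyc : τ.IsCycle := ⟨Classical.arbitrary ι, hfix _, fun y _ => hτ _ y⟩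
    have h1τ : (1 : Equiv.Perm ι) ≠ τ := fun h =>
      hfix (Classical.arbitrary ι) (by rw [← h]; rfl)
    rw [Matrix.det_apply', ← sum_subset (subset_univ {1, τ}), sum_pair h1τ]
    · have e1 : ∀ i, (1 - Matrix.of fun i j => if i = τ j then x i else 0 : Matrix ι ι R) i i = 1 := by
        intro i
        simp [(hfix i).symm]
      have e2 : ∀ i, (1 - Matrix.of fun i j => if i = τ j then x i else 0 : Matrix ι ι R) (τ i) i =
          -x (τ i) := by
        intro i
        simp [hfix i]
      have hsupp : τ.support = univ := by
        ext i
        simp [hfix i]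
      simp only [Equiv.Perm.one_apply, e1, e2, prod_const_one, prod_neg, card_univ,
        Equiv.prod_comp τ x, hcyc.sign, hsupp]
      have hsq : (-1 : R) ^ Fintype.card ι * (-1) ^ Fintype.card ι = 1 := by
        rw [← mul_pow]; simp
      simp only [Equiv.Perm.sign_one]
      push_cast
      rw [← mul_assoc, neg_mul, hsq]
      ring
    · intro π _ hπ
      simp only [mem_insert, mem_singleton, not_or] at hπ
      by_contra h0
      have hπi : ∀ i, π i = i ∨ π i = τ i := by
        intro i
        by_contra hi
        push Not at hi
        refine h0 (mul_eq_zero_of_right _ (prod_eq_zero (mem_univ i) ?_))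
        simp [hi.1, hi.2]
      have hex : ∃ i, π i = τ i := by
        by_contra hne
        push Not at hne
        exact hπ.1 (Equiv.ext fun i => (hπi i).resolve_right (hne i))
      obtain ⟨i, hi⟩ := hex
      refine hπ.2 (Equiv.ext fun j => ?_)
      obtain ⟨d, rfl⟩ := (hτ i j).exists_nat_pow_eq
      induction d with
      | zero => exact hi
      | succ d ih =>
        rw [pow_succ', Equiv.Perm.mul_apply]
        refine (hπi _).resolve_left fun h => ?_
        rw [← ih] at h
        exact hfix _ (ih.symm.trans (π.injective h))

variable {n : ℕ}

/-- The set of cycles (including the trivial ones) of a permutation. -/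
def Cycles (σ : Equiv.Perm (Fin n)) : Type := Quotient (Equiv.Perm.SameCycle.setoid σ)

/-- The cycle of an element. -/
def cycleMk (σ : Equiv.Perm (Fin n)) (i : Fin n) : Cycles σ :=
  Quotient.mk (Equiv.Perm.SameCycle.setoid σ) i

theorem cycleMk_surjective (σ : Equiv.Perm (Fin n)) : Function.Surjective (cycleMk σ) :=
  Quotient.mk_surjective

theorem cycleMk_eq_iff {σ : Equiv.Perm (Fin n)} {i j : Fin n} :
    cycleMk σ i = cycleMk σ j ↔ σ.SameCycle i j := Quotient.eq

instance (σ : Equiv.Perm (Fin n)) : Finite (Cycles σ) :=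
  Finite.of_surjective _ (cycleMk_surjective σ)

noncomputable instance (σ : Equiv.Perm (Fin n)) : DecidableEq (Cycles σ) := Classical.decEq _

noncomputable instance (σ : Equiv.Perm (Fin n)) : Fintype (Cycles σ) :=
  Fintype.ofFinite _

/-- The length of a cycle. -/
noncomputable def cycleSize (σ : Equiv.Perm (Fin n)) (c : Cycles σ) : ℕ :=
  contentOf (cycleMk σ) c

theorem cycleSize_pos (σ : Equiv.Perm (Fin n)) (c : Cycles σ) : 0 < cycleSize σ c := by
  obtain ⟨i, rfl⟩ := cycleMk_surjective σ c
  exact (card_pos (s := univ.filter fun k => cycleMk σ k = cycleMk σ i)).mpr ⟨i, mem_filter.mpr ⟨mem_univ _, rfl⟩⟩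

theorem cycleMk_apply (σ : Equiv.Perm (Fin n)) (i : Fin n) : cycleMk σ (σ i) = cycleMk σ i :=
  cycleMk_eq_iff.mpr (Equiv.Perm.sameCycle_apply_left.mpr (Equiv.Perm.SameCycle.refl _ _))

theorem colorSum_eq_prod {J R : Type*} [DecidableEq J] [Fintype J] [CommRing R]
    (σ : Equiv.Perm (Fin n)) (y : J → R) :
    colorSum σ y = ∏ c, ∑ j, y j ^ cycleSize σ c := by
  rw [prod_univ_sum, Fintype.piFinset_univ, colorSum]
  symm
  refine sum_nbij (fun F k => F (cycleMk σ k)) ?_ ?_ ?_ ?_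
  · intro F _
    simp only [mem_filter, mem_univ, true_and, funext_iff, Function.comp_apply, cycleMk_apply,
      implies_true]
  · intro F _ F' _ h
    funext c
    obtain ⟨i, rfl⟩ := cycleMk_surjective σ c
    exact congrFun h i
  · intro f hf
    simp only [coe_filter, mem_univ, true_and, Set.mem_ofPred_eq] at hf
    refine ⟨fun c => f (Function.surjInv (cycleMk_surjective σ) c), by simp, ?_⟩
    funext k
    exact comp_eq_of_sameCycle hf (cycleMk_eq_iff.mp (Function.surjInv_eq _ _))
  · intro F _
    exact (prod_comp_eq_prod_pow_contentOf (cycleMk σ) (fun c => y (F c))).symm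

theorem det_one_sub_monomial {R : Type*} [CommRing R] (σ : Equiv.Perm (Fin n)) (x : Fin n → R) :
    (1 - Matrix.of fun i j => if i = σ j then x i else 0 : Matrix (Fin n) (Fin n) R).det =
      ∏ c : Cycles σ, (1 - ∏ i with cycleMk σ i = c, x i) := by
  -- Any order will do: the matrix is block diagonal along the cycles.
  let _ : LinearOrder (Cycles σ) :=
    LinearOrder.lift' (Fintype.equivFin (Cycles σ)) (Equiv.injective _)
  have hb : (1 - Matrix.of fun i j => if i = σ j then x i else 0 :
      Matrix (Fin n) (Fin n) R).BlockTriangular (cycleMk σ) := by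
    intro i j hij
    have h1 : i ≠ j := fun h => by subst h; exact lt_irrefl _ hij
    have h2 : i ≠ σ j := fun h => by subst h; rw [cycleMk_apply] at hij; exact lt_irrefl _ hij
    simp [h1, h2]
  rw [hb.det_fintype]
  refine prod_congr rfl fun c _ => ?_
  have : Nonempty {i // cycleMk σ i = c} := by
    obtain ⟨i, rfl⟩ := cycleMk_surjective σ c
    exact ⟨⟨i, rfl⟩⟩
  let τ : Equiv.Perm {i // cycleMk σ i = c} :=
    σ.subtypePerm fun i => by rw [cycleMk_apply]
  have hτ : ∀ i j, τ.SameCycle i j := fun i j =>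
    Equiv.Perm.sameCycle_subtypePerm.mpr (cycleMk_eq_iff.mp (i.2.trans j.2.symm))
  have h := det_one_sub_transitive τ hτ (fun i => x i)
  rw [← prod_subtype (univ.filter fun i => cycleMk σ i = c) (by simp) x] at h
  rw [← h]
  congr 1
  ext i j
  simp [Matrix.toSquareBlock_def, Matrix.one_apply, τ, Subtype.ext_iff]

end Cycles

/-! ### Signed permutations: cycle signs and determinants. -/

section SignedPerm

open Finset

variable {n : ℕ}

/-- The sign of a cycle of a signed permutation. -/
noncomputable def cycleSign (R : Type*) [CommRing R] (ε : Fin n → ℤˣ) {σ : Equiv.Perm (Fin n)}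
    (c : Cycles σ) : R := ∏ i with cycleMk σ i = c, ((ε i : ℤ) : R)

theorem cycleSign_eq (R : Type*) [CommRing R] (ε : Fin n → ℤˣ) {σ : Equiv.Perm (Fin n)}
    (c : Cycles σ) : cycleSign R ε c = 1 ∨ cycleSign R ε c = -1 := by
  have h : cycleSign R ε c = (((∏ i with cycleMk σ i = c, ε i : ℤˣ) : ℤ) : R) := by
    simp [cycleSign]
  rcases Int.units_eq_one_or (∏ i with cycleMk σ i = c, ε i) with h1 | h1 <;> simp [h, h1]

theorem det_one_sub_reflB (w : WeylB n) :
    (1 - reflB n w).det = ∏ c : Cycles w.right, (1 - cycleSign ℝ w.left c) :=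
  det_one_sub_monomial w.right fun i => ((w.left i : ℤ) : ℝ)

theorem detOneSubQ_reflB (w : WeylB n) :
    detOneSubQ (reflB n) w =
      ∏ c : Cycles w.right,
        (1 - cycleSign (RatFunc ℂ) w.left c * RatFunc.X ^ cycleSize w.right c) := by
  have h : 1 - (Polynomial.X : Polynomial ℂ) • ((reflB n w).map (algebraMap ℝ ℂ)).map Polynomial.C =
      1 - Matrix.of fun i j => if i = w.right j then
        ((w.left i : ℤ) : Polynomial ℂ) * Polynomial.X else 0 := by
    congr 1
    ext i j : 1
    simp only [reflB, MonoidHom.coe_mk, OneHom.coe_mk, Matrix.smul_apply, Matrix.map_apply,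
      Matrix.of_apply, smul_eq_mul]
    split_ifs <;> simp [mul_comm]
  rw [detOneSubQ, Matrix.charpolyRev, h, det_one_sub_monomial, map_prod]
  refine prod_congr rfl fun c _ => ?_
  rw [prod_mul_distrib, prod_const, cycleSign, map_sub, map_one, map_mul, map_pow, map_prod,
    RatFunc.algebraMap_X]
  simp only [map_intCast]
  rfl

theorem prod_units_apply_sum {R : Type*} [CommRing R] (g : Fin n → ℤˣ → R) :
    ∑ ε : Fin n → ℤˣ, ∏ i, g i (ε i) = ∏ i, (g i 1 + g i (-1)) := by
  have h := prod_univ_sum (fun _ : Fin n => (univ : Finset ℤˣ)) g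
  rw [Fintype.piFinset_univ] at h
  rw [← h]
  refine prod_congr rfl fun i _ => ?_
  have : (univ : Finset ℤˣ) = {1, -1} := by decide
  rw [this, sum_pair (by decide)]

/-- Expand over sets `S` of cycles. If `S` is nonempty, a point on one of its cycles contributes `1
+ (-1) = 0` to the sum over signs; only the empty set remains. -/
theorem sum_prod_one_sub_cycleSign (R : Type*) [CommRing R] (σ : Equiv.Perm (Fin n)) :
    ∑ ε : Fin n → ℤˣ, ∏ c : Cycles σ, (1 - cycleSign R ε c) = 2 ^ n := by
  simp only [sub_eq_neg_add, prod_add, prod_const_one, mul_one, powerset_univ, prod_neg]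
  rw [sum_comm, sum_eq_single ∅]
  · simp [Fintype.card_units_int]
  · intro S _ hS
    obtain ⟨c, hc⟩ := nonempty_iff_ne_empty.mpr hS
    rw [← mul_sum]
    refine mul_eq_zero_of_right _ ?_
    have h : ∀ ε : Fin n → ℤˣ, ∏ c ∈ S, cycleSign R ε c =
        ∏ i, (fun (i : Fin n) (e : ℤˣ) => if cycleMk σ i ∈ S then ((e : ℤ) : R) else 1) i (ε i) := by
      intro ε
      simp only [cycleSign]
      rw [prod_ite, prod_const_one, mul_one, ← prod_fiberwise_of_maps_to
        (s := univ.filter fun i => cycleMk σ i ∈ S) (t := S) (g := cycleMk σ) (by simp)]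
      refine prod_congr rfl fun c hc => prod_congr ?_ fun _ _ => rfl
      ext i
      simp only [mem_filter, mem_univ, true_and]
      constructor
      · rintro rfl; exact ⟨hc, rfl⟩
      · exact fun h => h.2
    refine (sum_congr rfl fun ε _ => h ε).trans ((prod_units_apply_sum
      fun (i : Fin n) (e : ℤˣ) => if cycleMk σ i ∈ S then ((e : ℤ) : R) else 1).trans ?_)
    obtain ⟨i, rfl⟩ := cycleMk_surjective σ c
    refine prod_eq_zero (mem_univ i) ?_
    rw [if_pos hc, if_pos hc]
    simp
  · simp

theorem det_reflB (w : WeylB n) :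
    (reflB n w).det = sgn ℝ w.right * ∏ i, ((w.left i : ℤ) : ℝ) := by
  have h : reflB n w = Matrix.diagonal (fun i => ((w.left i : ℤ) : ℝ)) *
      (w.right⁻¹).permMatrix ℝ := by
    ext i j
    rw [Matrix.diagonal_mul]
    have hiff : i = w.right j ↔ j = w.right.symm i := by
      rw [Equiv.eq_symm_apply, eq_comm]
    simp [reflB, Equiv.Perm.permMatrix, PEquiv.toMatrix_apply, Equiv.toPEquiv_apply, hiff,
      eq_comm]
  rw [h, Matrix.det_mul, Matrix.det_diagonal, Matrix.det_permutation, mul_comm]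
  simp [sgn]

theorem reflB_transpose_mul (w : WeylB n) : (reflB n w).transpose * reflB n w = 1 := by
  ext i j
  rw [Matrix.mul_apply, sum_eq_single (w.right j)]
  · have hsq : ∀ u : ℤˣ, ((u : ℤ) : ℝ) * ((u : ℤ) : ℝ) = 1 := fun u => by
      rcases Int.units_eq_one_or u with h | h <;> simp [h]
    by_cases hij : i = j
    · subst hij
      simp [reflB, hsq]
    · simp [reflB, hij, Ne.symm hij]
  · intro k _ hk
    simp [reflB, hk]
  · simp

/-- On elliptic elements, the product of the signs is determined by the permutation. -/
theorem prod_left_mul_det_one_sub (w : WeylB n) :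
    (∏ i, ((w.left i : ℤ) : ℝ)) * (1 - reflB n w).det =
      (-1) ^ n * sgn ℝ w.right * (1 - reflB n w).det := by
  -- Orthogonality gives `det(1 - w) = (-1) ^ n det(w) det(1 - w)`.
  have h1 : 1 - reflB n w = ((reflB n w).transpose - 1) * reflB n w := by
    rw [sub_mul, reflB_transpose_mul, one_mul]
  have h2 : ((reflB n w).transpose - 1).det = (-1) ^ n * (1 - reflB n w).det := by
    rw [← Matrix.det_transpose, Matrix.transpose_sub, Matrix.transpose_transpose,
      Matrix.transpose_one, ← neg_sub, Matrix.det_neg, Fintype.card_fin]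
  have h3 : (1 - reflB n w).det = (-1) ^ n * (1 - reflB n w).det * (sgn ℝ w.right *
      ∏ i, ((w.left i : ℤ) : ℝ)) := by
    conv_lhs => rw [h1, Matrix.det_mul, h2, det_reflB]
  have hsq : (∏ i, ((w.left i : ℤ) : ℝ)) * (∏ i, ((w.left i : ℤ) : ℝ)) = 1 := by
    rw [← prod_mul_distrib]
    refine prod_eq_one fun i _ => ?_
    rcases Int.units_eq_one_or (w.left i) with h | h <;> simp [h]
  conv_lhs => rw [h3]
  linear_combination ((-1) ^ n * (1 - reflB n w).det * sgn ℝ w.right) * hsq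

end SignedPerm

/-! ### Principal specialization and the hook-content formula. -/

section Evaluation

open Finset

variable {K : Type*} [Field K]

theorem prod_fin_Ioi {M : Type*} [CommMonoid M] (m : ℕ) (F : ℕ → ℕ → M) :
    ∏ i : Fin m, ∏ j ∈ Ioi i, F i j = ∏ i ∈ range m, ∏ j ∈ Ioo i m, F i j := by
  rw [← Fin.prod_univ_eq_prod_range (fun i => ∏ j ∈ Ioo i m, F i j)]
  refine prod_congr rfl fun i _ => ?_
  refine prod_nbij (fun j => (j : ℕ)) ?_ ?_ ?_ ?_
  · intro j hj
    simp only [mem_Ioi] at hj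
    simp only [mem_Ioo]
    exact ⟨hj, j.2⟩
  · intro j _ j' _ h
    exact Fin.ext h
  · intro j hj
    simp only [coe_Ioo, Set.mem_Ioo] at hj
    exact ⟨⟨j, hj.2⟩, by simpa [Fin.lt_def] using hj.1, rfl⟩
  · intro j _; rfl

theorem det_pow_pow (t : K) (m : ℕ) (e : ℕ → ℕ) :
    (Matrix.of fun i k : Fin m => (t ^ (k : ℕ)) ^ e i).det =
      ∏ i ∈ range m, ∏ j ∈ Ioo i m, (t ^ e j - t ^ e i) := by
  have h : (Matrix.of fun i k : Fin m => (t ^ (k : ℕ)) ^ e i) =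
      Matrix.vandermonde fun i : Fin m => t ^ e i := by
    ext i k
    simp [Matrix.vandermonde_apply, ← pow_mul, mul_comm]
  rw [h, Matrix.det_vandermonde, prod_fin_Ioi m fun i j => t ^ e j - t ^ e i]

/-- The exponents `m + j - i` for `j < r` continue the interval `1, …, m - 1 - i`. Contents can be
negative, hence the integer power and the need for `t ≠ 0`. -/
theorem prod_content_row (t : K) (ht : t ≠ 0) (r m i : ℕ) (hi : i < m) :
    (∏ j ∈ range r, (1 - t ^ m * t ^ YoungDiagram.content (i, j))) *
      ∏ k ∈ Icc 1 (m - 1 - i), (1 - t ^ k) = ∏ k ∈ Icc 1 (r + (m - 1 - i)), (1 - t ^ k) := by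
  induction r with
  | zero => simp
  | succ r ih =>
    rw [prod_range_succ, mul_right_comm, ih, add_right_comm, prod_Icc_succ_top (by omega)]
    congr 2
    rw [← zpow_natCast, ← zpow_natCast, ← zpow_add₀ ht]
    congr 1
    simp only [YoungDiagram.content]
    omega

theorem prod_pairs_snd {M : Type*} [CommMonoid M] (m : ℕ) (F : ℕ → M) :
    ∏ i ∈ range m, ∏ j ∈ Ioo i m, F j = ∏ j ∈ range m, F j ^ j := by
  have h : ∀ j ∈ range m, F j ^ j = ∏ _i ∈ range j, F j := fun j _ => by simp
  rw [prod_congr rfl h, prod_sigma', prod_sigma']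
  refine prod_nbij' (fun x => ⟨x.2, x.1⟩) (fun x => ⟨x.2, x.1⟩) ?_ ?_ ?_ ?_ ?_
  · rintro ⟨i, j⟩ h
    simp only [mem_sigma, mem_range, mem_Ioo] at h ⊢
    omega
  · rintro ⟨i, j⟩ h
    simp only [mem_sigma, mem_range, mem_Ioo] at h ⊢
    omega
  all_goals simp

theorem nStat_eq_sum_range (lam : YoungDiagram) {m : ℕ} (hm : lam.colLen 0 ≤ m) :
    lam.nStat = ∑ i ∈ range m, i * lam.rowLen i := by
  refine sum_subset (range_subset_range.mpr hm) fun i _ hi => ?_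
  rw [mem_range, not_lt] at hi
  rw [lam.rowLen_eq_zero_of_colLen_le hi, mul_zero]

theorem prod_sub_pow_factor (t : K) (m : ℕ) (e : ℕ → ℕ)
    (he : ∀ i j, i < j → j < m → e j ≤ e i) :
    ∏ i ∈ range m, ∏ j ∈ Ioo i m, (t ^ e j - t ^ e i) =
      (∏ j ∈ range m, (t ^ e j) ^ j) *
        ∏ i ∈ range m, ∏ j ∈ Ioo i m, (1 - t ^ (e i - e j)) := by
  rw [← prod_pairs_snd m fun j => t ^ e j, ← prod_mul_distrib]
  refine prod_congr rfl fun i _ => ?_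
  rw [← prod_mul_distrib]
  refine prod_congr rfl fun j hj => ?_
  rw [mem_Ioo] at hj
  rw [mul_sub, mul_one, ← pow_add, Nat.add_sub_cancel' (he i j hj.1 hj.2)]

theorem prod_one_sub_pow_sub (t : K) {m i : ℕ} (hi : i < m) :
    ∏ j ∈ Ioo i m, (1 - t ^ (m - 1 - i - (m - 1 - j))) = ∏ k ∈ Icc 1 (m - 1 - i), (1 - t ^ k) := by
  refine prod_nbij' (fun j => j - i) (fun k => k + i) ?_ ?_ ?_ ?_ ?_
  · intro j hj; simp only [mem_Ioo, mem_Icc] at hj ⊢; omega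
  · intro j hj; simp only [mem_Ioo, mem_Icc] at hj ⊢; omega
  · intro j hj; simp only [mem_Ioo] at hj; omega
  · intro j hj; simp only [mem_Icc] at hj; omega
  · intro j hj
    simp only [mem_Ioo] at hj
    congr 2
    omega

/-- The hook-content evaluation of the quotient of alternants. -/
theorem prod_hook_mul_alternant (t : K) (ht : t ≠ 0) (lam : YoungDiagram) {m : ℕ}
    (hm : lam.colLen 0 ≤ m) :
    (∏ x ∈ lam.cells, (1 - t ^ lam.hook x)) *
      ∏ i ∈ range m, ∏ j ∈ Ioo i m,
        (t ^ (lam.rowLen j + (m - 1 - j)) - t ^ (lam.rowLen i + (m - 1 - i))) =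
      t ^ lam.nStat * (∏ x ∈ lam.cells, (1 - t ^ m * t ^ YoungDiagram.content x)) *
        ∏ i ∈ range m, ∏ j ∈ Ioo i m, (t ^ (m - 1 - j) - t ^ (m - 1 - i)) := by
  rw [prod_sub_pow_factor t m (fun i => lam.rowLen i + (m - 1 - i)) (fun i j hij hj => by
      have := lam.rowLen_anti _ _ hij.le
      omega),
    prod_sub_pow_factor t m (fun i => m - 1 - i) (fun i j hij hj => by omega),
    prod_cells_eq_prod_rows lam hm, prod_cells_eq_prod_rows lam hm]
  have h1 : ∏ j ∈ range m, (t ^ (lam.rowLen j + (m - 1 - j))) ^ j =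
      t ^ lam.nStat * ∏ j ∈ range m, (t ^ (m - 1 - j)) ^ j := by
    rw [nStat_eq_sum_range lam hm, ← prod_pow_eq_pow_sum, ← prod_mul_distrib]
    refine prod_congr rfl fun j _ => ?_
    rw [pow_add, mul_pow, ← pow_mul, mul_comm j]
  -- In each row both sides are the product of `1 - t ^ k` over the interval `1 ≤ k ≤ λ_i + m - 1 -
  -- i`.
  have h2 : (∏ i ∈ range m, ∏ j ∈ range (lam.rowLen i), (1 - t ^ lam.hook (i, j))) *
      ∏ i ∈ range m, ∏ j ∈ Ioo i m,
        (1 - t ^ (lam.rowLen i + (m - 1 - i) - (lam.rowLen j + (m - 1 - j)))) =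
      (∏ i ∈ range m, ∏ j ∈ range (lam.rowLen i), (1 - t ^ m * t ^ YoungDiagram.content (i, j))) *
        ∏ i ∈ range m, ∏ j ∈ Ioo i m, (1 - t ^ (m - 1 - i - (m - 1 - j))) := by
    rw [← prod_mul_distrib, ← prod_mul_distrib]
    refine prod_congr rfl fun i hi => ?_
    rw [mem_range] at hi
    rw [prod_one_sub_pow_sub t hi, prod_content_row t ht _ _ _ hi,
      ← prod_hook_row lam hm hi fun k => 1 - t ^ k]
    congr 1
    refine prod_congr rfl fun j hj => ?_
    rw [mem_Ioo] at hj
    have := lam.rowLen_anti _ _ hj.1.le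
    congr 2
    omega
  rw [h1]
  linear_combination (t ^ lam.nStat * ∏ j ∈ range m, (t ^ (m - 1 - j)) ^ j) * h2

variable {n : ℕ} {lam : YoungDiagram}

theorem alternant_rev_ne_zero (t : K) (ht : t ≠ 0) (ht1 : ∀ k, 0 < k → t ^ k ≠ 1) (m : ℕ) :
    ∏ i ∈ range m, ∏ j ∈ Ioo i m, (t ^ (m - 1 - j) - t ^ (m - 1 - i)) ≠ 0 := by
  refine prod_ne_zero_iff.mpr fun i _ => prod_ne_zero_iff.mpr fun j hj h => ?_
  rw [mem_Ioo] at hj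
  have h2 : m - 1 - i = (m - 1 - j) + (j - i) := by omega
  rw [h2, pow_add, sub_eq_zero] at h
  exact ht1 (j - i) (by omega) (mul_left_cancel₀ (pow_ne_zero (m - 1 - j) ht)
    (by rw [mul_one]; exact h.symm))

theorem sum_frobFun_mul_colorSum_geom (t : K) (ht : t ≠ 0) (ht1 : ∀ k, 0 < k → t ^ k ≠ 1)
    (T : lam.cells ≃ Fin n) {m : ℕ} (hm : lam.colLen 0 ≤ m) :
    (∑ σ : Equiv.Perm (Fin n), (frobFun (shiftedPart lam m) σ : K) *
      colorSum σ (fun k : Fin m => t ^ (k : ℕ))) * (∏ x ∈ lam.cells, (1 - t ^ lam.hook x)) =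
      n.factorial * (t ^ lam.nStat *
        ∏ x ∈ lam.cells, (1 - t ^ m * t ^ YoungDiagram.content x)) := by
  have h := sum_frobFun_mul_colorSum (fun k : Fin m => t ^ (k : ℕ)) (shiftedPart lam m)
    (sum_shiftedPart T hm)
  have hrev : ∀ i : Fin m, (i.rev : ℕ) = m - 1 - i := fun i => by rw [Fin.val_rev]; omega
  simp only [shiftedPart, hrev] at h
  rw [det_pow_pow t m (fun i => m - 1 - i),
    det_pow_pow t m (fun i => lam.rowLen i + (m - 1 - i))] at h
  refine mul_right_cancel₀ (alternant_rev_ne_zero t ht ht1 m) ?_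
  rw [mul_right_comm, h]
  linear_combination (n.factorial : K) * prod_hook_mul_alternant t ht lam hm

theorem colorSum_geom (t : K) (ht1 : ∀ k, 0 < k → t ^ k ≠ 1) (σ : Equiv.Perm (Fin n)) (m : ℕ) :
    colorSum σ (fun k : Fin m => t ^ (k : ℕ)) =
      ∏ c, (1 - (t ^ m) ^ cycleSize σ c) / (1 - t ^ cycleSize σ c) := by
  rw [colorSum_eq_prod]
  refine prod_congr rfl fun c _ => ?_
  rw [eq_div_iff (sub_ne_zero.mpr (ht1 _ (cycleSize_pos σ c)).symm)]
  rw [Fin.sum_univ_eq_sum_range (fun k => (t ^ k) ^ cycleSize σ c)]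
  have h : ∀ k, (t ^ k) ^ cycleSize σ c = (t ^ cycleSize σ c) ^ k := fun k => by
    rw [← pow_mul, ← pow_mul, mul_comm]
  rw [sum_congr rfl fun k _ => h k, h m]
  exact geom_sum_mul_neg _ _

/-- The principal specialization of the Frobenius characteristic of a Specht module:
the value at `p_k = (1 - u ^ k) / (1 - t ^ k)`. -/
theorem sum_character_mul_prod_cycles [Algebra ℂ K] (t u : K) (ht : t ≠ 0)
    (ht1 : ∀ k, 0 < k → t ^ k ≠ 1) (T : lam.cells ≃ Fin n) :
    (∑ σ : Equiv.Perm (Fin n), algebraMap ℂ K ((spechtRep T).character σ) *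
      ∏ c, (1 - u ^ cycleSize σ c) / (1 - t ^ cycleSize σ c)) *
        (∏ x ∈ lam.cells, (1 - t ^ lam.hook x)) =
      n.factorial * (t ^ lam.nStat *
        ∏ x ∈ lam.cells, (1 - u * t ^ YoungDiagram.content x)) := by
  -- Both sides are polynomials in `u`. They agree at `u = t ^ m` for every `m` at least the number
  -- of rows, and these values are distinct because no positive power of `t` is 1.
  let P : Polynomial K := (∑ σ : Equiv.Perm (Fin n),
    Polynomial.C (algebraMap ℂ K ((spechtRep T).character σ)) *
      ∏ c, ((1 - Polynomial.X ^ cycleSize σ c) * Polynomial.C (1 - t ^ cycleSize σ c)⁻¹)) *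
        Polynomial.C (∏ x ∈ lam.cells, (1 - t ^ lam.hook x))
  let Q : Polynomial K := Polynomial.C (n.factorial * t ^ lam.nStat : K) *
    ∏ x ∈ lam.cells, (1 - Polynomial.X * Polynomial.C (t ^ YoungDiagram.content x))
  have hP : ∀ u, P.eval u = (∑ σ : Equiv.Perm (Fin n),
      algebraMap ℂ K ((spechtRep T).character σ) *
      ∏ c, (1 - u ^ cycleSize σ c) / (1 - t ^ cycleSize σ c)) *
        (∏ x ∈ lam.cells, (1 - t ^ lam.hook x)) := fun u => by
    simp [P, Polynomial.eval_finsetSum, Polynomial.eval_prod, div_eq_mul_inv]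
  have hQ : ∀ u, Q.eval u = n.factorial * (t ^ lam.nStat *
      ∏ x ∈ lam.cells, (1 - u * t ^ YoungDiagram.content x)) := fun u => by
    simp only [Q, Polynomial.eval_mul, Polynomial.eval_C, Polynomial.eval_prod,
      Polynomial.eval_sub, Polynomial.eval_one, Polynomial.eval_X, mul_assoc]
  have hinj : Function.Injective fun d : ℕ => t ^ (lam.colLen 0 + d) := by
    have key : ∀ a b : ℕ, t ^ (lam.colLen 0 + a) = t ^ (lam.colLen 0 + b) → ¬ a < b := by
      intro a b hab hlt
      have h2 : lam.colLen 0 + b = (lam.colLen 0 + a) + (b - a) := by omega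
      rw [h2, pow_add _ _ (b - a)] at hab
      exact ht1 (b - a) (by omega) (mul_left_cancel₀ (pow_ne_zero (lam.colLen 0 + a) ht)
        (by rw [mul_one]; exact hab.symm))
    intro a b hab
    exact le_antisymm (not_lt.mp (key b a hab.symm)) (not_lt.mp (key a b hab))
  have hPQ : P = Q := by
    refine Polynomial.eq_of_infinite_eval_eq P Q
      ((Set.infinite_range_of_injective hinj).mono ?_)
    rintro _ ⟨d, rfl⟩
    rw [Set.mem_ofPred_eq, hP, hQ,
      ← sum_frobFun_mul_colorSum_geom t ht ht1 T (Nat.le_add_right _ d)]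
    congr 1
    refine sum_congr rfl fun σ _ => ?_
    rw [colorSum_geom t ht1, spechtRep_character_eq_frobFun T (Nat.le_add_right _ d), map_intCast]
  rw [← hP, hPQ, hQ]

end Evaluation

/-! ### The elliptic fake degrees of types B and D. -/

section FakeDegrees

open Finset

variable {n : ℕ}

theorem RatFunc.X_pow_ne_one (k : ℕ) (hk : 0 < k) : (RatFunc.X : RatFunc ℂ) ^ k ≠ 1 := by
  intro h
  rw [← RatFunc.algebraMap_X, ← map_pow, ← map_one (algebraMap (Polynomial ℂ) (RatFunc ℂ))] at h
  have := congrArg Polynomial.natDegree (RatFunc.algebraMap_injective ℂ h)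
  rw [Polynomial.natDegree_X_pow, Polynomial.natDegree_one] at this
  omega

theorem C_ofReal_det_one_sub_reflB (w : WeylB n) :
    RatFunc.C (((1 - reflB n w).det : ℝ) : ℂ) =
      ∏ c : Cycles w.right, (1 - cycleSign (RatFunc ℂ) w.left c) := by
  simp [det_one_sub_reflB, cycleSign]

/-- A cycle of sign +1 makes the numerator vanish, so every denominator may be replaced by its value
at sign -1; the signs then occur only in the numerator. -/
theorem det_one_sub_div_detOneSubQ (w : WeylB n) :
    RatFunc.C (((1 - reflB n w).det : ℝ) : ℂ) / detOneSubQ (reflB n) w =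
      (∏ c : Cycles w.right, (1 - cycleSign (RatFunc ℂ) w.left c)) *
        ∏ c : Cycles w.right, (1 + RatFunc.X ^ cycleSize w.right c)⁻¹ := by
  rw [C_ofReal_det_one_sub_reflB, detOneSubQ_reflB, ← prod_div_distrib, ← prod_mul_distrib]
  refine prod_congr rfl fun c _ => ?_
  rcases cycleSign_eq (RatFunc ℂ) w.left c with h | h
  · simp [h]
  · rw [h, neg_one_mul, sub_neg_eq_add, sub_neg_eq_add, div_eq_mul_inv]

theorem sum_weylB {M : Type*} [AddCommMonoid M] (F : WeylB n → M) :
    ∑ w, F w = ∑ σ : Equiv.Perm (Fin n), ∑ ε : Fin n → ℤˣ, F ⟨ε, σ⟩ := by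
  rw [Fintype.sum_equiv SemidirectProduct.equivProd F (fun x => F ⟨x.1, x.2⟩) (fun _ => rfl),
    Fintype.sum_prod_type_right]

theorem card_weylB : Fintype.card (WeylB n) = 2 ^ n * n.factorial := by
  rw [Fintype.card_congr SemidirectProduct.equivProd]
  simp [Fintype.card_perm, Fintype.card_units_int]

/-- The elliptic fake degree of an inflated class function. -/
theorem sum_weylB_inflated (χ : Equiv.Perm (Fin n) → ℂ) :
    ∑ w : WeylB n, RatFunc.C (χ w.right) * RatFunc.C (((1 - reflB n w).det : ℝ) : ℂ) /
        detOneSubQ (reflB n) w =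
      2 ^ n * ∑ σ, RatFunc.C (χ σ) * ∏ c, (1 + RatFunc.X ^ cycleSize σ c)⁻¹ := by
  simp only [mul_div_assoc, det_one_sub_div_detOneSubQ]
  rw [sum_weylB, mul_sum]
  refine sum_congr rfl fun σ _ => ?_
  simp only [mul_left_comm (RatFunc.C (χ σ))]
  have h := sum_prod_one_sub_cycleSign (RatFunc ℂ) σ
  rw [← h, sum_mul]

theorem fakeB_eq_sum (lam : YoungDiagram) (h : lam.card = n) :
    fakeB lam h = (RatFunc.X - 1) ^ n / (Fintype.card (WeylB n) : RatFunc ℂ) *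
      ∑ w : WeylB n, RatFunc.C ((sigmaRep lam h).character w.right) *
        RatFunc.C (((1 - reflB n w).det : ℝ) : ℂ) / detOneSubQ (reflB n) w := rfl

theorem fakeD_eq_sum (lam : YoungDiagram) (h : lam.card = n) :
    fakeD lam h = (RatFunc.X - 1) ^ n / (Fintype.card (WeylD n) : RatFunc ℂ) *
      ∑ w : WeylD n, RatFunc.C ((sigmaRep lam h).character w.1.right) *
        RatFunc.C (((1 - reflB n w.1).det : ℝ) : ℂ) / detOneSubQ (reflB n) w.1 := rfl

theorem fakeB_eq_prod (lam : YoungDiagram) (h : lam.card = n) :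
    fakeB lam h = (RatFunc.X - 1) ^ n /
        (∏ x ∈ lam.cells, (1 - (RatFunc.X : RatFunc ℂ) ^ (2 * lam.hook x))) *
      ((RatFunc.X : RatFunc ℂ) ^ (2 * lam.nStat) * ∏ x ∈ lam.cells,
        (1 - (RatFunc.X : RatFunc ℂ) ^ (2 * YoungDiagram.content x + 1 : ℤ))) := by
  have hX : (RatFunc.X : RatFunc ℂ) ≠ 0 := RatFunc.X_ne_zero
  have ht1 : ∀ k, 0 < k → ((RatFunc.X : RatFunc ℂ) ^ 2) ^ k ≠ 1 := fun k hk => by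
    rw [← pow_mul]
    exact RatFunc.X_pow_ne_one _ (by omega)
  -- With `t = q ^ 2` and `u = q`, the factor of a cycle is `(1 - q ^ s) / (1 - q ^ (2 s)) = 1 / (1
  -- + q ^ s)`, and `u t ^ c` is `q ^ (2 c + 1)`.
  have key := sum_character_mul_prod_cycles (RatFunc.X ^ 2 : RatFunc ℂ) RatFunc.X
    (pow_ne_zero 2 hX) ht1 (someTableau lam h)
  have hc : ∀ s : ℕ, 0 < s → (1 - (RatFunc.X : RatFunc ℂ) ^ s) / (1 - (RatFunc.X ^ 2) ^ s) =
      (1 + RatFunc.X ^ s)⁻¹ := fun s hs => by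
    have h1 : (1 - (RatFunc.X : RatFunc ℂ) ^ s) ≠ 0 :=
      sub_ne_zero.mpr (RatFunc.X_pow_ne_one s hs).symm
    have h2 : (1 - ((RatFunc.X : RatFunc ℂ) ^ 2) ^ s) = (1 - RatFunc.X ^ s) * (1 + RatFunc.X ^ s) := by
      ring
    rw [h2, div_mul_eq_div_div, div_self h1, one_div]
  have hsum : ∀ σ : Equiv.Perm (Fin n),
      ∏ c, (1 - (RatFunc.X : RatFunc ℂ) ^ cycleSize σ c) / (1 - (RatFunc.X ^ 2) ^ cycleSize σ c) =
        ∏ c, (1 + RatFunc.X ^ cycleSize σ c)⁻¹ := fun σ =>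
    prod_congr rfl fun c _ => hc _ (cycleSize_pos σ c)
  have hz : ∀ z : ℤ, (RatFunc.X : RatFunc ℂ) * (RatFunc.X ^ 2) ^ z = RatFunc.X ^ (2 * z + 1) :=
    fun z => by
      rw [zpow_add_one₀ hX, zpow_mul, mul_comm]
      norm_cast
  simp only [hsum, hz, RatFunc.algebraMap_eq_C] at key
  have hH : ∏ x ∈ lam.cells, (1 - (RatFunc.X : RatFunc ℂ) ^ (2 * lam.hook x)) ≠ 0 :=
    prod_ne_zero_iff.mpr fun x _ =>
      sub_ne_zero.mpr (RatFunc.X_pow_ne_one _ (by simp [YoungDiagram.hook])).symm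
  have hf : (n.factorial : RatFunc ℂ) ≠ 0 := Nat.cast_ne_zero.mpr n.factorial_ne_zero
  rw [fakeB_eq_sum, sum_weylB_inflated, card_weylB]
  simp only [pow_mul] at hH ⊢
  rw [div_mul_eq_mul_div, div_mul_eq_mul_div, div_eq_div_iff (by simp [n.factorial_ne_zero]) hH]
  push_cast
  linear_combination ((RatFunc.X : RatFunc ℂ) - 1) ^ n * 2 ^ n * key

theorem sigmaRep_transpose_character (lam : YoungDiagram) (h : lam.card = n)
    (σ : Equiv.Perm (Fin n)) :
    (sigmaRep lam.transpose (YoungDiagram.card_transpose_eq h)).character σ =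
      sgn ℂ σ * (sigmaRep lam h).character σ := by
  -- The tableau chosen for the transposed shape need not be the transposed tableau; Frobenius'
  -- formula shows that the character depends only on the shape.
  rw [← spechtRep_transposeTableau_character, spechtRep_character_eq_frobFun _ le_rfl,
    spechtRep_character_eq_frobFun _ le_rfl]

theorem two_mul_sum_weylD {K : Type*} [Field K] (F : WeylB n → K) :
    2 * ∑ w : WeylD n, F w = ∑ w : WeylB n, (1 + ∏ i, ((w.left i : ℤ) : K)) * F w := by
  classical
  rw [← sum_subtype (univ.filter fun w : WeylB n => w ∈ WeylD n) (by simp) F, sum_filter, mul_sum]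
  refine sum_congr rfl fun w _ => ?_
  have h1 : ∏ i, ((w.left i : ℤ) : K) = (((∏ i, w.left i : ℤˣ) : ℤ) : K) := by simp
  have h2 : w ∈ WeylD n ↔ ∏ i, w.left i = 1 := Iff.rfl
  rw [h1]
  rcases Int.units_eq_one_or (∏ i, w.left i) with h | h
  · rw [if_pos (h2.mpr h), h, Units.val_one, Int.cast_one, one_add_one_eq_two]
  · rw [if_neg (by rw [h2, h]; decide), h]
    simp

/-- The index is 2 because the product of the signs is a nontrivial character, which requires `n ≥
1`. -/
theorem two_mul_card_weylD (hn : 1 ≤ n) :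
    2 * (Fintype.card (WeylD n) : RatFunc ℂ) = Fintype.card (WeylB n) := by
  have h := two_mul_sum_weylD (n := n) (K := RatFunc ℂ) (fun _ => 1)
  simp only [mul_one, sum_add_distrib, sum_const, card_univ, nsmul_eq_mul] at h
  rw [h, sum_weylB]
  have h0 : ∀ σ : Equiv.Perm (Fin n), ∑ ε : Fin n → ℤˣ,
      ∏ i, (((SemidirectProduct.mk ε σ : WeylB n).left i : ℤ) : RatFunc ℂ) = 0 := fun σ => by
    refine (prod_units_apply_sum fun (_ : Fin n) (e : ℤˣ) => ((e : ℤ) : RatFunc ℂ)).trans ?_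
    exact prod_eq_zero (mem_univ ⟨0, hn⟩) (by simp)
  exact (congrArg₂ (· + ·) rfl (sum_eq_zero fun σ _ => h0 σ)).trans (add_zero _)

theorem prod_left_mul_C_det (w : WeylB n) :
    (∏ i, ((w.left i : ℤ) : RatFunc ℂ)) * RatFunc.C (((1 - reflB n w).det : ℝ) : ℂ) =
      (-1) ^ n * RatFunc.C (sgn ℂ w.right) * RatFunc.C (((1 - reflB n w).det : ℝ) : ℂ) := by
  have h := congrArg (fun r : ℝ => RatFunc.C (r : ℂ)) (prod_left_mul_det_one_sub w)
  simpa [sgn] using h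

theorem fakeD_eq_add (hn : 1 ≤ n) (lam : YoungDiagram) (h : lam.card = n) :
    fakeD lam h = fakeB lam h +
      (-1) ^ n * fakeB lam.transpose (YoungDiagram.card_transpose_eq h) := by
  have hsum := two_mul_sum_weylD fun w : WeylB n =>
    RatFunc.C ((sigmaRep lam h).character w.right) *
      RatFunc.C (((1 - reflB n w).det : ℝ) : ℂ) / detOneSubQ (reflB n) w
  -- On the support of `det(1 - w)` the product of the signs is `(-1) ^ n sgn σ`, and `sgn` times
  -- the character of λ is that of the transpose.
  have hterm : ∀ w : WeylB n, (1 + ∏ i, ((w.left i : ℤ) : RatFunc ℂ)) *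
      (RatFunc.C ((sigmaRep lam h).character w.right) *
        RatFunc.C (((1 - reflB n w).det : ℝ) : ℂ) / detOneSubQ (reflB n) w) =
      RatFunc.C ((sigmaRep lam h).character w.right) *
        RatFunc.C (((1 - reflB n w).det : ℝ) : ℂ) / detOneSubQ (reflB n) w +
      (-1) ^ n * (RatFunc.C
        ((sigmaRep lam.transpose (YoungDiagram.card_transpose_eq h)).character w.right) *
        RatFunc.C (((1 - reflB n w).det : ℝ) : ℂ) / detOneSubQ (reflB n) w) := fun w => by
    rw [sigmaRep_transpose_character lam h, map_mul]
    simp only [div_eq_mul_inv]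
    linear_combination RatFunc.C ((sigmaRep lam h).character w.right) *
      (detOneSubQ (reflB n) w)⁻¹ * prod_left_mul_C_det w
  rw [sum_congr rfl fun w _ => hterm w, sum_add_distrib, ← mul_sum] at hsum
  have hcard := two_mul_card_weylD hn
  rw [fakeD_eq_sum, fakeB_eq_sum, fakeB_eq_sum, ← hcard, mul_left_comm, ← mul_add, ← hsum]
  have hD : (Fintype.card (WeylD n) : RatFunc ℂ) ≠ 0 := Nat.cast_ne_zero.mpr Fintype.card_ne_zero
  field_simp

end FakeDegrees

theorem propositionp (n : ℕ) (hn : 1 ≤ n) (lam : YoungDiagram) (hlam : lam.card = n) :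
    fakeD lam hlam
        = fakeB lam hlam
          + (-1) ^ n * fakeB lam.transpose (YoungDiagram.card_transpose_eq hlam) ∧
    fakeD lam hlam
        = (RatFunc.X - 1) ^ n
            / (∏ x ∈ lam.cells, (1 - (RatFunc.X : RatFunc ℂ) ^ (2 * lam.hook x))) *
          ((RatFunc.X : RatFunc ℂ) ^ (2 * lam.nStat)
              * ∏ x ∈ lam.cells,
                  (1 - (RatFunc.X : RatFunc ℂ) ^ (2 * YoungDiagram.content x + 1 : ℤ))
            + (-1) ^ n * (RatFunc.X : RatFunc ℂ) ^ (2 * lam.transpose.nStat)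
              * ∏ x ∈ lam.transpose.cells,
                  (1 - (RatFunc.X : RatFunc ℂ) ^ (2 * YoungDiagram.content x + 1 : ℤ))) := by
  refine ⟨fakeD_eq_add hn lam hlam, ?_⟩
  have hhook : ∏ x ∈ lam.transpose.cells,
      (1 - (RatFunc.X : RatFunc ℂ) ^ (2 * lam.transpose.hook x)) =
      ∏ x ∈ lam.cells, (1 - (RatFunc.X : RatFunc ℂ) ^ (2 * lam.hook x)) := by
    rw [prod_cells_transpose]
    simp only [YoungDiagram.hook_transpose, Prod.swap_swap]
  rw [fakeD_eq_add hn, fakeB_eq_prod, fakeB_eq_prod, hhook]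
  ring
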